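/- For a real symmetric positive definite $d\times d$ matrix $Q$ (a positive definite quadratic form, PQF) write $Q[x]=x^{t}Qx$, let \[ \mu(Q)=\max_{x\in\mathbb R^d}\ \min_{v\in\mathbb Z^d} Q[x-v],\qquad \Theta(Q)=\sqrt{\frac{\mu(Q)^d}{\det Q}}\cdot\kappa_d, \] where $\kappa_d$ is the volume of the $d$-dimensional Euclidean unit ball. ($\Theta(Q)$ is the covering density of the lattice with Gram matrix $Q$.) A PQF $Q$ is said to give a \emph{locally optimal lattice covering} if it is a local minimum of $\Theta$ on the cone of PQFs in $d$ variables, i.e. $\Theta(Q)\le\Theta(Q')$ for all PQFs $Q'$ in some neighbourhood of $Q$. Let \[ Q_{\mathsf E_6^*}=\begin{pmatrix} 4 & 1 & 2 & 2 &-1 & 1\\ 1 & 4 & 2 & 2 & 2 & 1\\ 2 & 2 & 4 & 1 & 1 & 2\\ 2 & 2 & 1 & 4 & 1 & 2\\ -1 & 2 & 1 & 1 & 4 & 2\\ 1 & 1 & 2 & 2 & 2 & 4 \end{pmatrix},\qquad R_1=\begin{pmatrix} 12 & 3 & 6 & 6 & -3 & 3\\ 3 & 7 & 4 & 4 & 3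 & 2\\ 6 & 4 & 8 & 3 & 1 & 4\\ 6 & 4 & 3 & 8 & 1 & 4\\ -3 & 3 & 1 & 1 & 7 & 3\\ 3 & 2 & 4 & 4 & 3 & 7 \end{pmatrix}. \] \textbf{Theorem.} The matrix \[ Q^{c2}_6 = Q_{\mathsf E_6^*}+\frac{\sqrt{1057}-1}{88}\,R_1 \] is positive definite and gives a locally optimal lattice covering. Its covering density is \[ \Theta(Q^{c2}_6)=\frac{\sqrt{1124895337698\sqrt{1057}-33713139497730}}{3543122}\cdot\kappa_6 , \] and numerically $|\Theta(Q^{c2}_6)-2.466121649|<10^{-9}$. -/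

import Mathlib

namespace LatticeCovering

noncomputable section

/-- The value `Q[x] = xᵗ Q x` of the quadratic form with matrix `Q` at `x`. -/
def formValue {d : ℕ} (Q : Matrix (Fin d) (Fin d) ℝ) (x : Fin d → ℝ) : ℝ :=
  x ⬝ᵥ Q.mulVec x

/-- The squared `Q`-distance `min_{v ∈ ℤ^d} Q[x - v]` of `x` to the integer lattice. -/
def sqDistLattice {d : ℕ} (Q : Matrix (Fin d) (Fin d) ℝ) (x : Fin d → ℝ) : ℝ :=
  ⨅ v : Fin d → ℤ, formValue Q (fun i => x i - (v i : ℝ))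

/-- The inhomogeneous minimum `μ(Q) = max_{x ∈ ℝ^d} min_{v ∈ ℤ^d} Q[x - v]`.
For positive definite `Q` the infimum and the supremum are over bounded sets,
see `bddBelow_formValue` and `bddAbove_sqDistLattice`. -/
def inhomMin {d : ℕ} (Q : Matrix (Fin d) (Fin d) ℝ) : ℝ :=
  ⨆ x : Fin d → ℝ, sqDistLattice Q x

/-- The volume `κ_d` of the Euclidean unit ball of dimension `d`. -/
def unitBallVolume (d : ℕ) : ℝ :=
  (MeasureTheory.volume (Metric.closedBall (0 : EuclideanSpace ℝ (Fin d)) 1)).toReal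

/-- The covering density `Θ(Q) = √(μ(Q)^d / det Q) · κ_d`. -/
def coveringDensity {d : ℕ} (Q : Matrix (Fin d) (Fin d) ℝ) : ℝ :=
  Real.sqrt (inhomMin Q ^ d / Q.det) * unitBallVolume d

/-- `Q` is positive definite and gives a locally optimal lattice covering: it is a local minimum
of the covering density on the cone of positive definite quadratic forms (`Matrix.PosDef`
includes symmetry), in the usual topology of the space of matrices. -/
def IsLocallyOptimalLatticeCovering {d : ℕ} (Q : Matrix (Fin d) (Fin d) ℝ) : Prop :=
  Q.PosDef ∧ IsLocalMinOn coveringDensity {Q' : Matrix (Fin d) (Fin d) ℝ | Q'.PosDef} Q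

/-- A positive definite quadratic form of the lattice `E₆*`. -/
def QE6star : Matrix (Fin 6) (Fin 6) ℝ :=
  !![ 4, 1, 2, 2, -1, 1;
      1, 4, 2, 2,  2, 1;
      2, 2, 4, 1,  1, 2;
      2, 2, 1, 4,  1, 2;
     -1, 2, 1, 1,  4, 2;
      1, 1, 2, 2,  2, 4]

/-- The quadratic form `R₁`. -/
def R1 : Matrix (Fin 6) (Fin 6) ℝ :=
  !![12, 3, 6, 6, -3, 3;
      3, 7, 4, 4,  3, 2;
      6, 4, 8, 3,  1, 4;
      6, 4, 3, 8,  1, 4;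
     -3, 3, 1, 1,  7, 3;
      3, 2, 4, 4,  3, 7]

/-- The quadratic form `Q₆^{c2} = Q_{E₆*} + ((√1057 - 1) / 88) R₁`. -/
def Qc2 : Matrix (Fin 6) (Fin 6) ℝ :=
  QE6star + ((Real.sqrt 1057 - 1) / 88) • R1

theorem formValue_nonneg {d : ℕ} {Q : Matrix (Fin d) (Fin d) ℝ} (hQ : Q.PosDef)
    (x : Fin d → ℝ) : 0 ≤ formValue Q x := by
  have h := hQ.posSemidef.dotProduct_mulVec_nonneg x
  simpa [formValue] using h

theorem bddBelow_formValue {d : ℕ} {Q : Matrix (Fin d) (Fin d) ℝ} (hQ : Q.PosDef)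
    (x : Fin d → ℝ) :
    BddBelow (Set.range fun v : Fin d → ℤ => formValue Q (fun i => x i - (v i : ℝ))) :=
  ⟨0, by rintro _ ⟨v, rfl⟩; exact formValue_nonneg hQ _⟩

theorem bddAbove_sqDistLattice {d : ℕ} {Q : Matrix (Fin d) (Fin d) ℝ} (hQ : Q.PosDef) :
    BddAbove (Set.range (sqDistLattice Q)) := by
  refine ⟨∑ i, ∑ j, |Q i j|, ?_⟩
  rintro _ ⟨x, rfl⟩
  refine (ciInf_le (bddBelow_formValue hQ x) (fun i => ⌊x i⌋)).trans ?_
  have hf : ∀ i, |x i - (⌊x i⌋ : ℝ)| ≤ 1 := fun i => by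
    rw [← Int.fract, abs_of_nonneg (Int.fract_nonneg _)]
    exact (Int.fract_lt_one _).le
  simp only [formValue, dotProduct, Matrix.mulVec, Finset.mul_sum]
  refine Finset.sum_le_sum fun i _ => Finset.sum_le_sum fun j _ => (le_abs_self _).trans ?_
  rw [abs_mul, abs_mul]
  calc |x i - (⌊x i⌋ : ℝ)| * (|Q i j| * |x j - (⌊x j⌋ : ℝ)|)
      ≤ 1 * (|Q i j| * 1) := by
        gcongr
        · exact hf i
        · exact hf j
    _ = |Q i j| := by ring

end

end LatticeCovering

namespace LatticeCovering

/-! In the coordinates of `glueBasis`, `Qc2` becomes β(u s² + |w|²) on a lattice glued from 4ℤ and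
2D₅, with u = `optRatio`. Put r(u) = (21u² - 14u + 13)/4, the squared circumradius of one "deep"
lattice simplex for β = 1.

Upper bound on μ: images of three lattice simplices under lattice isometries fill space (`covered`),
and the vertices of each lie in a ball of squared radius r(u). A point of a simplex is then within
squared distance r(u) of one of its vertices (`Covered.of_barycentric`).

Lower bound on μ near the form: the deep simplex is Delaunay with a uniform margin, so it stays
Delaunay for every nearby H (`deepDefect_nonneg_of_near`) and μ(H) is at least its squared
circumradius. Completing the square bounds that radius below by `-deepDefect H z` for every z, which
is linear in H once z is fixed (`neg_deepDefect_le_inhomMin`). Take z to be the circumcentre for the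
unperturbed form and average over even sign changes and cyclic permutations, which preserve both
lattice and form. The equation 231u² - 70u - 13 = 0, the stationarity of r(u)⁶/u, makes the averaged
functional r(u)/6 times the trace of diag(u,1,…,1)⁻¹H (`trace_le_inhomMin`). AM-GM for eigenvalues
turns this into μ(H)⁶/det H ≥ r(u)⁶/u, with equality at the form itself. -/

/-! ### The glue lattice, its symmetries and a fundamental prism -/

/-- The lattice points `(a, b)` with `b` congruent to `a` times the spinor weight of `D₅`. -/
def IsGlue (a : ℤ) (b : Fin 5 → ℤ) : Prop :=
  (∀ i, 2 ∣ b i - a) ∧ 4 ∣ (∑ i, b i) - a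

instance (a : ℤ) (b : Fin 5 → ℤ) : Decidable (IsGlue a b) := by
  unfold IsGlue; infer_instance

/-- The point `(s, w)` has squared distance at most `r` to a glue lattice point, measured with
`u s² + |w|²`. -/
def Covered (u r s : ℝ) (w : Fin 5 → ℝ) : Prop :=
  ∃ (a : ℤ) (b : Fin 5 → ℤ), IsGlue a b ∧ u * (s - a) ^ 2 + ∑ i, (w i - b i) ^ 2 ≤ r

/-- The parallel axis identity in one coordinate: the mean square about the barycentre `t` is the
mean square about `c` minus (t - c)². -/
lemma sum_mul_sq_sub {ι : Type*} [Fintype ι] (lam z : ι → ℝ) (t c : ℝ) (h1 : ∑ i, lam i = 1)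
    (ht : ∑ i, lam i * z i = t) :
    ∑ i, lam i * (t - z i) ^ 2 = ∑ i, lam i * (z i - c) ^ 2 - (t - c) ^ 2 := by
  have e : ∀ i, lam i * (t - z i) ^ 2
      = lam i * (z i - c) ^ 2 + (t ^ 2 - c ^ 2) * lam i - 2 * (t - c) * (lam i * z i) := by
    intro i; ring
  simp_rw [e, Finset.sum_sub_distrib, Finset.sum_add_distrib, ← Finset.mul_sum, h1, ht]
  ring

/-- By the parallel axis identity, the weighted mean of the squared distances from the point to the
vertices is at most `r`, so some vertex is that close. The centre need not be the circumcentre. -/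
lemma Covered.of_barycentric {u r s : ℝ} {w : Fin 5 → ℝ} (hu : 0 ≤ u)
    (a : Fin 7 → ℤ) (b : Fin 7 → Fin 5 → ℤ) (hL : ∀ i, IsGlue (a i) (b i))
    (lam : Fin 7 → ℝ) (c₀ : ℝ) (c : Fin 5 → ℝ) (h0 : ∀ i, 0 ≤ lam i) (h1 : ∑ i, lam i = 1)
    (hs : ∑ i, lam i * a i = s) (hw : ∀ j, ∑ i, lam i * b i j = w j)
    (hr : ∀ i, u * (a i - c₀) ^ 2 + ∑ j, (b i j - c j) ^ 2 ≤ r) : Covered u r s w := by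
  by_contra hcon
  have hlt : ∀ i, r < u * (s - a i) ^ 2 + ∑ j, (w j - b i j) ^ 2 := by
    intro i
    by_contra hi
    exact hcon ⟨a i, b i, hL i, not_lt.mp hi⟩
  have key : ∑ i, lam i * (u * (s - a i) ^ 2 + ∑ j, (w j - b i j) ^ 2)
      = ∑ i, lam i * (u * (a i - c₀) ^ 2 + ∑ j, (b i j - c j) ^ 2)
        - (u * (s - c₀) ^ 2 + ∑ j, (w j - c j) ^ 2) := by
    have e1 := sum_mul_sq_sub lam (fun i => (a i : ℝ)) s c₀ h1 hs
    have e2 := fun j => sum_mul_sq_sub lam (fun i => (b i j : ℝ)) (w j) (c j) h1 (hw j)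
    have split : ∀ (f : Fin 7 → ℝ) (g : Fin 7 → Fin 5 → ℝ),
        ∑ i, lam i * (u * f i + ∑ j, g i j) = u * ∑ i, lam i * f i + ∑ j, ∑ i, lam i * g i j := by
      intro f g
      rw [Finset.sum_comm]
      simp_rw [mul_add, Finset.sum_add_distrib, Finset.mul_sum]
      congr 1
      exact Finset.sum_congr rfl fun i _ => by ring
    rw [split, split, e1, Finset.sum_congr rfl fun j _ => e2 j, Finset.sum_sub_distrib]
    ring
  have hle : ∑ i, lam i * (u * (a i - c₀) ^ 2 + ∑ j, (b i j - c j) ^ 2) ≤ r := by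
    calc _ ≤ ∑ i, lam i * r := Finset.sum_le_sum fun i _ => mul_le_mul_of_nonneg_left (hr i) (h0 i)
      _ = r := by rw [← Finset.sum_mul, h1, one_mul]
  have hsq : 0 ≤ u * (s - c₀) ^ 2 + ∑ j, (w j - c j) ^ 2 := by positivity
  have hge : ∀ i ∈ Finset.univ,
      0 ≤ lam i * (u * (s - a i) ^ 2 + ∑ j, (w j - b i j) ^ 2 - r) := fun i _ =>
    mul_nonneg (h0 i) (sub_nonneg.mpr (hlt i).le)
  have hsum : ∑ i, lam i * (u * (s - a i) ^ 2 + ∑ j, (w j - b i j) ^ 2 - r) = 0 := by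
    refine le_antisymm ?_ (Finset.sum_nonneg hge)
    simp_rw [mul_sub _ _ r, Finset.sum_sub_distrib]
    rw [← Finset.sum_mul, h1, key]
    linarith
  have hz := (Finset.sum_eq_zero_iff_of_nonneg hge).mp hsum
  have : ∑ i, lam i = 0 := Finset.sum_eq_zero fun i hi =>
    (mul_eq_zero.mp (hz i hi)).resolve_right (sub_pos.mpr (hlt i)).ne'
  linarith

lemma IsGlue.sub {a a' : ℤ} {b b' : Fin 5 → ℤ} (h : IsGlue a b) (h' : IsGlue a' b') :
    IsGlue (a - a') (b - b') := by
  obtain ⟨h1, h2⟩ := h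
  obtain ⟨h3, h4⟩ := h'
  refine ⟨fun i => ?_, ?_⟩
  · have := h1 i; have := h3 i; simp only [Pi.sub_apply]; omega
  · simp only [Pi.sub_apply, Finset.sum_sub_distrib]; omega

lemma IsGlue.neg {a : ℤ} {b : Fin 5 → ℤ} (h : IsGlue a b) : IsGlue (-a) (-b) := by
  simpa using IsGlue.sub (a := 0) (b := 0) (by decide) h

lemma IsGlue.add {a a' : ℤ} {b b' : Fin 5 → ℤ} (h : IsGlue a b) (h' : IsGlue a' b') :
    IsGlue (a + a') (b + b') := by
  simpa using h.sub h'.neg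

lemma IsGlue.perm {a : ℤ} {b : Fin 5 → ℤ} (h : IsGlue a b) (σ : Equiv.Perm (Fin 5)) :
    IsGlue a (b ∘ σ) :=
  ⟨fun i => h.1 (σ i), by simpa [Equiv.sum_comp σ b] using h.2⟩

/-- Flipping one sign changes the sum of the `b i` by 2 `b i`, which is 2`a` modulo 4; negating `a`
compensates. Hence the factor ∏ `e i`. -/
lemma IsGlue.sign {a : ℤ} {b : Fin 5 → ℤ} (h : IsGlue a b) (e : Fin 5 → ℤ)
    (he : ∀ i, e i = 1 ∨ e i = -1) : IsGlue ((∏ i, e i) * a) (fun i => e i * b i) := by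
  obtain ⟨h1, h2⟩ := h
  simp only [Fin.forall_fin_succ, Fin.succ_zero_eq_one, Fin.succ_one_eq_two] at h1 he
  have h10 := h1.1
  simp only [IsGlue, Fin.forall_fin_succ, Fin.sum_univ_five, Fin.prod_univ_five] at h1 h2 he ⊢
  simp only [Fin.reduceSucc, IsEmpty.forall_iff, and_true] at *
  obtain ⟨h0, h1, h3, h4, h5⟩ := h1
  obtain ⟨e0 | e0, e1 | e1, e2 | e2, e3 | e3, e4 | e4⟩ := he <;>
    simp only [e0, e1, e2, e3, e4] <;> omega

lemma Covered.of_sub {u r s : ℝ} {w : Fin 5 → ℝ} {a : ℤ} {b : Fin 5 → ℤ} (hL : IsGlue a b)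
    (h : Covered u r (s - a) (fun i => w i - b i)) : Covered u r s w := by
  obtain ⟨a', b', hL', h⟩ := h
  refine ⟨a + a', b + b', hL.add hL', ?_⟩
  simpa [sub_sub] using h

lemma Covered.of_perm {u r s : ℝ} {w : Fin 5 → ℝ} (σ : Equiv.Perm (Fin 5))
    (h : Covered u r s (w ∘ σ)) : Covered u r s w := by
  obtain ⟨a, b, hL, h⟩ := h
  refine ⟨a, b ∘ σ.symm, hL.perm _, ?_⟩
  rw [← Equiv.sum_comp σ]
  simpa using h

lemma Covered.of_sign {u r s : ℝ} {w : Fin 5 → ℝ} (e : Fin 5 → ℤ)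
    (he : ∀ i, e i = 1 ∨ e i = -1)
    (h : Covered u r ((∏ i, e i : ℤ) * s) (fun i => e i * w i)) : Covered u r s w := by
  obtain ⟨a, b, hL, h⟩ := h
  have sq : ∀ i, ((e i : ℤ) : ℝ) ^ 2 = 1 := by
    intro i; rcases he i with h | h <;> simp [h]
  have sqp : ((∏ i, e i : ℤ) : ℝ) ^ 2 = 1 := by
    push_cast; rw [← Finset.prod_pow]; simp [sq]
  refine ⟨(∏ i, e i) * a, fun i => e i * b i, hL.sign e he, le_trans (le_of_eq ?_) h⟩
  congr 1
  · push_cast at sqp ⊢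
    linear_combination (u * s ^ 2 - u * a ^ 2) * (-sqp)
  · refine Finset.sum_congr rfl fun i _ => ?_
    push_cast
    linear_combination ((b i : ℝ) ^ 2 - w i ^ 2) * (sq i)

lemma Covered.of_one_sub {u r s : ℝ} {w : Fin 5 → ℝ}
    (h : Covered u r (1 - s) (fun i => 1 - w i)) : Covered u r s w := by
  obtain ⟨a, b, hL, h⟩ := h
  refine ⟨1 - a, fun i => 1 - b i, IsGlue.sub (a := 1) (b := fun _ => 1) (by decide) hL,
    le_trans (le_of_eq ?_) h⟩
  push_cast
  congr 1
  · ring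
  · exact Finset.sum_congr rfl fun i _ => by ring

/-- Every point is equivalent under symmetries of the glue lattice to one of a fixed prism. -/
lemma covered_of_chamber {u r : ℝ}
    (h : ∀ (s : ℝ) (w : Fin 5 → ℝ), -3 / 2 ≤ s → s ≤ 1 / 2 → w 0 ≤ 1 → w 1 ≤ w 0 → w 2 ≤ w 1 →
      w 3 ≤ w 2 → w 4 ≤ w 3 → 0 ≤ w 4 → Covered u r s w) (s : ℝ) (w : Fin 5 → ℝ) :
    Covered u r s w := by
  have sorted : ∀ (s : ℝ) (w : Fin 5 → ℝ), -3 / 2 ≤ s → s ≤ 1 / 2 → (∀ i, 0 ≤ w i) →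
      (∀ i, w i ≤ 1) → Covered u r s w := by
    intro s w hs hs' h0 h1
    refine Covered.of_perm (Tuple.sort fun i => -w i) ?_
    have hm := Tuple.monotone_sort fun i => -w i
    have hm' : ∀ i j, i ≤ j → w (Tuple.sort (fun i => -w i) j) ≤ w (Tuple.sort (fun i => -w i) i) :=
      fun i j hij => neg_le_neg_iff.mp (hm hij)
    exact h _ _ hs hs' (h1 _) (hm' _ _ (by decide)) (hm' _ _ (by decide)) (hm' _ _ (by decide))
      (hm' _ _ (by decide)) (h0 _)
  have box : ∀ (s : ℝ) (w : Fin 5 → ℝ), (∀ i, 0 ≤ w i) → (∀ i, w i ≤ 1) → Covered u r s w := by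
    intro s w h0 h1
    have hf := Int.floor_le ((s + 3 / 2) / 4)
    have hf' := Int.lt_floor_add_one ((s + 3 / 2) / 4)
    -- Translation by (4, 0) brings `s` into [-3/2, 5/2], and the point reflection x ↦ 1 - x
    -- exchanges the two halves of this interval.
    refine Covered.of_sub (a := 4 * ⌊(s + 3 / 2) / 4⌋) (b := 0)
      ⟨fun i => by simp only [Pi.zero_apply]; omega, by simp⟩ ?_
    push_cast
    set k : ℝ := (⌊(s + 3 / 2) / 4⌋ : ℝ)
    simp only [Pi.zero_apply, Int.cast_zero, sub_zero]
    rcases le_total (s - 4 * k) (1 / 2) with hle | hle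
    · exact sorted _ _ (by linarith) hle h0 h1
    · exact Covered.of_one_sub (sorted _ _ (by linarith) (by linarith)
        (fun i => by linarith [h1 i]) (fun i => by linarith [h0 i]))
  have big : ∀ (s : ℝ) (w : Fin 5 → ℝ), (∀ i, |w i| ≤ 1) → Covered u r s w := by
    intro s w h1
    refine Covered.of_sign (fun i => if 0 ≤ w i then 1 else -1)
      (fun i => by by_cases h : 0 ≤ w i <;> simp [h]) (box _ _ ?_ ?_) <;>
    · intro i
      have := abs_le.mp (h1 i)
      by_cases h : 0 ≤ w i <;> simp only [h, if_true, if_false] <;> push_cast <;> linarith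
  refine Covered.of_sub (a := 2 * ∑ i, round (w i / 2)) (b := fun i => 2 * round (w i / 2))
    ⟨fun i => (dvd_mul_right _ _).sub (dvd_mul_right _ _), by rw [Finset.mul_sum]; simp⟩ (big _ _ fun i => ?_)
  have := abs_le.mp (abs_sub_round (w i / 2))
  push_cast
  rw [abs_le]
  constructor <;> linarith

lemma Covered.of_isometry {u r s : ℝ} {w : Fin 5 → ℝ} (σ : Fin 5 → Fin 5)
    (hσ : Function.Injective σ) (e : Fin 5 → ℤ) (he : ∀ i, e i = 1 ∨ e i = -1) (E : ℤ)
    (hE : ∏ i, e i = E) (a : ℤ) (b : Fin 5 → ℤ) (hL : IsGlue a b)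
    (h : Covered u r (E * (s - a)) (fun i => e i * (w (σ i) - b i))) :
    Covered u r s w := by
  have hσ' : Function.Bijective σ := Finite.injective_iff_bijective.mp hσ
  refine Covered.of_perm (Equiv.ofBijective σ hσ') (Covered.of_sub hL (Covered.of_sign e he ?_))
  rwa [hE]

/-! ### Three simplices whose images fill the prism -/

/-- The hypotheses are nonnegativity of the barycentric coordinates. The centre used is the exact
circumcentre, at squared distance r(u) from all seven vertices. -/
lemma covered_of_mem_deepSimplex {u s : ℝ} {w : Fin 5 → ℝ} (hu : 0 ≤ u)
    (k0 : 0 ≤ -s / 4 - w 0 / 4 - w 1 / 4 - w 2 / 4 + w 3 / 4 - w 4 / 4 + 1)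
    (k1 : 0 ≤ w 3 / 2 + w 4 / 2)
    (k2 : 0 ≤ w 2 / 2 - w 3 / 2)
    (k3 : 0 ≤ w 1 / 2 - w 3 / 2)
    (k4 : 0 ≤ w 0 / 2 - w 3 / 2)
    (k5 : 0 ≤ w 3 / 2 - w 4 / 2)
    (k6 : 0 ≤ s / 4 - w 0 / 4 - w 1 / 4 - w 2 / 4 + w 3 / 4 + w 4 / 4) :
    Covered u ((21 * u ^ 2 - 14 * u + 13) / 4) s w := by
  refine Covered.of_barycentric hu ![0, 1, 2, 2, 2, 3, 4]
    ![![0, 0, 0, 0, 0], ![1, 1, 1, 1, 1], ![0, 0, 2, 0, 0], ![0, 2, 0, 0, 0], ![2, 0, 0, 0, 0], ![1, 1, 1, 1, -1], ![0, 0, 0, 0, 0]] (by decide)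
    ![-s / 4 - w 0 / 4 - w 1 / 4 - w 2 / 4 + w 3 / 4 - w 4 / 4 + 1, w 3 / 2 + w 4 / 2, w 2 / 2 - w 3 / 2, w 1 / 2 - w 3 / 2, w 0 / 2 - w 3 / 2, w 3 / 2 - w 4 / 2, s / 4 - w 0 / 4 - w 1 / 4 - w 2 / 4 + w 3 / 4 + w 4 / 4]
    (2) ![1 - u, 1 - u, 1 - u, -1/2 + 3/2 * u, 0] ?_ ?_ ?_ ?_ ?_
  · intro i; fin_cases i <;> simp <;> linarith
  · simp [Fin.sum_univ_succ]; ring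
  · simp [Fin.sum_univ_succ]; ring
  · intro j; fin_cases j <;> simp [Fin.sum_univ_succ] <;> ring
  · intro i; fin_cases i <;> norm_num [Fin.sum_univ_succ] <;> linarith

/-- This simplex and the shallow one fit in balls slightly smaller than the deep circumball, so a
rounded rational centre suffices. The quadratic equation for `u` makes the required inequalities
linear. -/
lemma covered_of_mem_mediumSimplex {u s : ℝ} {w : Fin 5 → ℝ} (hu : 0 ≤ u)
    (hq : 231 * u ^ 2 - 70 * u - 13 = 0) (h1 : 0.433 < u) (h2 : u < 0.43301)
    (k0 : 0 ≤ -s / 4 - w 0 / 4 - w 1 / 4 - w 2 / 4 + w 3 / 4 - w 4 / 4 + 1)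
    (k1 : 0 ≤ -s / 4 + w 0 / 4 + w 1 / 4 + w 2 / 4 - w 3 / 4 - w 4 / 4)
    (k2 : 0 ≤ -s / 4 + w 0 / 4 + w 1 / 4 + w 2 / 4 + w 3 / 4 + w 4 / 4)
    (k3 : 0 ≤ s / 4 - w 0 / 4 - w 1 / 4 + w 2 / 4 - w 3 / 4 + w 4 / 4)
    (k4 : 0 ≤ s / 4 - w 0 / 4 + w 1 / 4 - w 2 / 4 - w 3 / 4 + w 4 / 4)
    (k5 : 0 ≤ s / 4 + w 0 / 4 - w 1 / 4 - w 2 / 4 - w 3 / 4 + w 4 / 4)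
    (k6 : 0 ≤ w 3 / 2 - w 4 / 2) :
    Covered u ((21 * u ^ 2 - 14 * u + 13) / 4) s w := by
  refine Covered.of_barycentric hu ![0, 1, 1, 2, 2, 2, 3]
    ![![0, 0, 0, 0, 0], ![1, 1, 1, -1, -1], ![1, 1, 1, 1, 1], ![0, 0, 2, 0, 0], ![0, 2, 0, 0, 0], ![2, 0, 0, 0, 0], ![1, 1, 1, 1, -1]] (by decide)
    ![-s / 4 - w 0 / 4 - w 1 / 4 - w 2 / 4 + w 3 / 4 - w 4 / 4 + 1, -s / 4 + w 0 / 4 + w 1 / 4 + w 2 / 4 - w 3 / 4 - w 4 / 4, -s / 4 + w 0 / 4 + w 1 / 4 + w 2 / 4 + w 3 / 4 + w 4 / 4, s / 4 - w 0 / 4 - w 1 / 4 + w 2 / 4 - w 3 / 4 + w 4 / 4, s / 4 - w 0 / 4 + w 1 / 4 - w 2 / 4 - w 3 / 4 + w 4 / 4, s / 4 + w 0 / 4 - w 1 / 4 - w 2 / 4 - w 3 / 4 + w 4 / 4, w 3 / 2 - w 4 / 2]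
    (183/100) ![16/25, 16/25, 16/25, 7/100, -7/100] ?_ ?_ ?_ ?_ ?_
  · intro i; fin_cases i <;> simp <;> linarith
  · simp [Fin.sum_univ_succ]; ring
  · simp [Fin.sum_univ_succ]; ring
  · intro j; fin_cases j <;> simp [Fin.sum_univ_succ] <;> ring
  · intro i; fin_cases i <;> norm_num [Fin.sum_univ_succ] <;> linarith

lemma covered_of_mem_shallowSimplex {u s : ℝ} {w : Fin 5 → ℝ} (hu : 0 ≤ u)
    (hq : 231 * u ^ 2 - 70 * u - 13 = 0) (h1 : 0.433 < u) (h2 : u < 0.43301)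
    (k0 : 0 ≤ -s / 4 - w 0 / 4 - w 1 / 4 - w 2 / 4 - w 3 / 4 + w 4 / 4 + 1)
    (k1 : 0 ≤ -s / 4 + w 0 / 4 + w 1 / 4 - w 2 / 4 - w 3 / 4 + w 4 / 4)
    (k2 : 0 ≤ w 3 / 2 - w 4 / 2)
    (k3 : 0 ≤ w 2 / 2 - w 4 / 2)
    (k4 : 0 ≤ w 2 / 2 + w 3 / 2)
    (k5 : 0 ≤ s / 4 - w 0 / 4 + w 1 / 4 - w 2 / 4 - w 3 / 4 + w 4 / 4)
    (k6 : 0 ≤ s / 4 + w 0 / 4 - w 1 / 4 - w 2 / 4 - w 3 / 4 + w 4 / 4) :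
    Covered u ((21 * u ^ 2 - 14 * u + 13) / 4) s w := by
  refine Covered.of_barycentric hu ![0, 0, 1, 1, 1, 2, 2]
    ![![0, 0, 0, 0, 0], ![2, 2, 0, 0, 0], ![1, 1, -1, 1, -1], ![1, 1, 1, -1, -1], ![1, 1, 1, 1, 1], ![0, 2, 0, 0, 0], ![2, 0, 0, 0, 0]] (by decide)
    ![-s / 4 - w 0 / 4 - w 1 / 4 - w 2 / 4 - w 3 / 4 + w 4 / 4 + 1, -s / 4 + w 0 / 4 + w 1 / 4 - w 2 / 4 - w 3 / 4 + w 4 / 4, w 3 / 2 - w 4 / 2, w 2 / 2 - w 4 / 2, w 2 / 2 + w 3 / 2, s / 4 - w 0 / 4 + w 1 / 4 - w 2 / 4 - w 3 / 4 + w 4 / 4, s / 4 + w 0 / 4 - w 1 / 4 - w 2 / 4 - w 3 / 4 + w 4 / 4]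
    (1) ![1, 1, 7/25, 7/25, -7/25] ?_ ?_ ?_ ?_ ?_
  · intro i; fin_cases i <;> simp <;> linarith
  · simp [Fin.sum_univ_succ]; ring
  · simp [Fin.sum_univ_succ]; ring
  · intro j; fin_cases j <;> simp [Fin.sum_univ_succ] <;> ring
  · intro i; fin_cases i <;> norm_num [Fin.sum_univ_succ] <;> linarith

set_option maxHeartbeats 1000000 in
/-- Three orbits of simplices cover the prism, so every point is within the asserted distance. -/
lemma covered {u : ℝ} (hq : 231 * u ^ 2 - 70 * u - 13 = 0) (h1 : 0.433 < u) (h2 : u < 0.43301)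
    (s : ℝ) (w : Fin 5 → ℝ) : Covered u ((21 * u ^ 2 - 14 * u + 13) / 4) s w := by
  have hu : 0 ≤ u := by linarith
  refine covered_of_chamber ?_ s w
  intro s w hs hs' h0 h10 h21 h32 h43 h4
  -- In each of the seventeen cases, the sign tests and the prism inequalities give the seven
  -- barycentric inequalities for one image of a simplex; `Covered.of_isometry` carries that image
  -- to the standard one.
  rcases le_total 0 (s + w 0 - w 1 + w 2 - w 3 - w 4) with h | h
  · rcases le_total 0 (s - w 0 + w 1 - w 2 + w 3 - w 4) with h | h
    · rcases le_total 0 (s - w 0 - w 1 + w 2 - w 3 + w 4) with h | h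
      · rcases le_total 0 (s - w 0 - w 1 - w 2 + w 3 + w 4) with h | h
        · refine .of_isometry ![0, 1, 2, 3, 4] (by decide) ![1, 1, 1, 1, 1] (by decide) 1 (by decide) 0 ![0, 0, 0, 0, 0] (by decide)
            (covered_of_mem_deepSimplex hu ?_ ?_ ?_ ?_ ?_ ?_ ?_) <;>
            simp <;> linarith
        · refine .of_isometry ![0, 1, 2, 3, 4] (by decide) ![1, 1, 1, 1, 1] (by decide) 1 (by decide) 0 ![0, 0, 0, 0, 0] (by decide)
            (covered_of_mem_mediumSimplex hu hq h1 h2 ?_ ?_ ?_ ?_ ?_ ?_ ?_) <;>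
            simp <;> linarith
      · rcases le_total 0 (s - w 0 + w 1 - w 2 - w 3 + w 4) with h | h
        · rcases le_total 0 (s - w 0 - w 1 + w 2 + w 3 - w 4) with h | h
          · refine .of_isometry ![3, 4, 2, 0, 1] (by decide) ![-1, 1, -1, -1, 1] (by decide) (-1) (by decide) 3 ![1, -1, 1, 1, 1] (by decide)
              (covered_of_mem_mediumSimplex hu hq h1 h2 ?_ ?_ ?_ ?_ ?_ ?_ ?_) <;>
              simp <;> linarith
          · refine .of_isometry ![0, 1, 2, 3, 4] (by decide) ![1, 1, 1, 1, 1] (by decide) 1 (by decide) 0 ![0, 0, 0, 0, 0] (by decide)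
              (covered_of_mem_shallowSimplex hu hq h1 h2 ?_ ?_ ?_ ?_ ?_ ?_ ?_) <;>
              simp <;> linarith
        · rcases le_total 0 (s - w 0 - w 1 + w 2 + w 3 - w 4) with h | h
          · refine .of_isometry ![3, 4, 2, 1, 0] (by decide) ![-1, 1, -1, -1, 1] (by decide) (-1) (by decide) 3 ![1, -1, 1, 1, 1] (by decide)
              (covered_of_mem_deepSimplex hu ?_ ?_ ?_ ?_ ?_ ?_ ?_) <;>
              simp <;> linarith
          · refine .of_isometry ![3, 4, 2, 0, 1] (by decide) ![-1, 1, -1, 1, 1] (by decide) 1 (by decide) (-1) ![1, -1, 1, 1, 1] (by decide)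
              (covered_of_mem_mediumSimplex hu hq h1 h2 ?_ ?_ ?_ ?_ ?_ ?_ ?_) <;>
              simp <;> linarith
    · rcases le_total 0 (s - w 0 + w 1 + w 2 - w 3 - w 4) with h | h
      · rcases le_total 0 (s + w 0 - w 1 - w 2 + w 3 - w 4) with h | h
        · refine .of_isometry ![0, 1, 2, 3, 4] (by decide) ![-1, 1, 1, 1, 1] (by decide) (-1) (by decide) 2 ![2, 0, 0, 0, 0] (by decide)
            (covered_of_mem_mediumSimplex hu hq h1 h2 ?_ ?_ ?_ ?_ ?_ ?_ ?_) <;>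
            simp <;> linarith
        · refine .of_isometry ![3, 4, 2, 0, 1] (by decide) ![1, 1, -1, 1, 1] (by decide) (-1) (by decide) 1 ![-1, -1, 1, 1, 1] (by decide)
            (covered_of_mem_shallowSimplex hu hq h1 h2 ?_ ?_ ?_ ?_ ?_ ?_ ?_) <;>
            simp <;> linarith
      · rcases le_total 0 (s + w 0 - w 1 - w 2 + w 3 - w 4) with h | h
        · refine .of_isometry ![0, 1, 2, 3, 4] (by decide) ![-1, 1, 1, 1, 1] (by decide) (-1) (by decide) 2 ![2, 0, 0, 0, 0] (by decide)
            (covered_of_mem_deepSimplex hu ?_ ?_ ?_ ?_ ?_ ?_ ?_) <;>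
            simp <;> linarith
        · refine .of_isometry ![0, 1, 2, 3, 4] (by decide) ![-1, 1, 1, 1, -1] (by decide) 1 (by decide) (-2) ![2, 0, 0, 0, 0] (by decide)
            (covered_of_mem_mediumSimplex hu hq h1 h2 ?_ ?_ ?_ ?_ ?_ ?_ ?_) <;>
            simp <;> linarith
  · rcases le_total 0 (s + w 0 + w 1 - w 2 + w 3 + w 4) with h | h
    · rcases le_total 0 (s + w 0 - w 1 + w 2 + w 3 + w 4) with h | h
      · rcases le_total 0 (s + w 0 + w 1 - w 2 - w 3 - w 4) with h | h
        · refine .of_isometry ![3, 4, 2, 0, 1] (by decide) ![-1, -1, -1, 1, 1] (by decide) (-1) (by decide) 1 ![1, 1, 1, 1, 1] (by decide)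
            (covered_of_mem_mediumSimplex hu hq h1 h2 ?_ ?_ ?_ ?_ ?_ ?_ ?_) <;>
            simp <;> linarith
        · refine .of_isometry ![3, 4, 2, 1, 0] (by decide) ![-1, -1, -1, -1, 1] (by decide) 1 (by decide) (-3) ![1, 1, 1, 1, 1] (by decide)
            (covered_of_mem_deepSimplex hu ?_ ?_ ?_ ?_ ?_ ?_ ?_) <;>
            simp <;> linarith
      · rcases le_total 0 (s + w 0 + w 1 - w 2 - w 3 - w 4) with h | h
        · refine .of_isometry ![0, 1, 2, 3, 4] (by decide) ![1, 1, 1, 1, -1] (by decide) (-1) (by decide) 0 ![0, 0, 0, 0, 0] (by decide)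
            (covered_of_mem_shallowSimplex hu hq h1 h2 ?_ ?_ ?_ ?_ ?_ ?_ ?_) <;>
            simp <;> linarith
        · refine .of_isometry ![3, 4, 2, 0, 1] (by decide) ![-1, -1, -1, -1, 1] (by decide) 1 (by decide) (-3) ![1, 1, 1, 1, 1] (by decide)
            (covered_of_mem_mediumSimplex hu hq h1 h2 ?_ ?_ ?_ ?_ ?_ ?_ ?_) <;>
            simp <;> linarith
    · rcases le_total 0 (s + w 0 + w 1 + w 2 - w 3 + w 4) with h | h
      · rcases le_total 0 (s / 4 - w 0 / 4 - w 1 / 4 - w 2 / 4 + w 3 / 4 + w 4 / 4 + 1) with h | h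
        · refine .of_isometry ![0, 1, 2, 3, 4] (by decide) ![1, 1, 1, 1, -1] (by decide) (-1) (by decide) 0 ![0, 0, 0, 0, 0] (by decide)
            (covered_of_mem_mediumSimplex hu hq h1 h2 ?_ ?_ ?_ ?_ ?_ ?_ ?_) <;>
            simp <;> linarith
        · refine .of_isometry ![3, 4, 2, 0, 1] (by decide) ![1, 1, -1, -1, 1] (by decide) 1 (by decide) (-3) ![-1, -1, 1, 1, 1] (by decide)
            (covered_of_mem_shallowSimplex hu hq h1 h2 ?_ ?_ ?_ ?_ ?_ ?_ ?_) <;>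
            simp <;> linarith
      · refine .of_isometry ![0, 1, 2, 3, 4] (by decide) ![1, 1, 1, 1, 1] (by decide) 1 (by decide) (-4) ![0, 0, 0, 0, 0] (by decide)
          (covered_of_mem_deepSimplex hu ?_ ?_ ?_ ?_ ?_ ?_ ?_) <;>
          simp <;> linarith

/-! ### Transfer between ℤ⁶ and the glue lattice -/

/-- The change of coordinates from `ℤ⁶` to the glue lattice. -/
def glueBasis : Matrix (Fin 6) (Fin 6) ℝ :=
  !![4, 1, 2, 2, -1, 1;
     0, 1, 2, 0, 1, 1;
     0, 1, 0, 2, 1, 1;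
     0, 1, 0, 0, -1, -1;
     0, 1, 0, 0, 1, -1;
     0, 1, 0, 0, 1, 1]

lemma glueBasis_det_sq : glueBasis.det ^ 2 = 4096 := by
  have h : glueBasis.det = 64 ∨ glueBasis.det = -64 := by
    simp [glueBasis, Matrix.det_succ_column_zero, Fin.sum_univ_succ, Fin.succAbove]
    norm_num
  rcases h with h | h <;> rw [h] <;> norm_num

lemma glueBasis_isUnit_det : IsUnit glueBasis.det := by
  refine isUnit_iff_ne_zero.mpr fun h => ?_
  have := glueBasis_det_sq
  rw [h] at this
  norm_num at this

/-- The glue vector with the given integer coordinates. -/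
def glueVec (a : ℤ) (b : Fin 5 → ℤ) : Fin 6 → ℝ :=
  Matrix.vecCons (a : ℝ) fun i => (b i : ℝ)

lemma glueBasis_mulVec (x : Fin 6 → ℝ) :
    glueBasis.mulVec x = ![4 * x 0 + x 1 + 2 * x 2 + 2 * x 3 - x 4 + x 5,
      x 1 + 2 * x 2 + x 4 + x 5, x 1 + 2 * x 3 + x 4 + x 5, x 1 - x 4 - x 5, x 1 + x 4 - x 5,
      x 1 + x 4 + x 5] := by
  ext i
  fin_cases i <;> simp [glueBasis, Matrix.mulVec, dotProduct, Fin.sum_univ_succ] <;> ring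

lemma glueBasis_mulVec_intCast (v : Fin 6 → ℤ) :
    ∃ a b, IsGlue a b ∧ glueBasis.mulVec (fun i => (v i : ℝ)) = glueVec a b := by
  refine ⟨4 * v 0 + v 1 + 2 * v 2 + 2 * v 3 - v 4 + v 5, ![v 1 + 2 * v 2 + v 4 + v 5,
    v 1 + 2 * v 3 + v 4 + v 5, v 1 - v 4 - v 5, v 1 + v 4 - v 5, v 1 + v 4 + v 5], ?_, ?_⟩
  · constructor
    · intro i
      fin_cases i <;> simp <;> omega
    · simp [Fin.sum_univ_five]; omega
  · rw [glueBasis_mulVec]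
    ext i
    fin_cases i <;> simp [glueVec]

lemma IsGlue.exists_intCast {a : ℤ} {b : Fin 5 → ℤ} (h : IsGlue a b) :
    ∃ v : Fin 6 → ℤ, glueBasis.mulVec (fun i => (v i : ℝ)) = glueVec a b := by
  obtain ⟨h1, h2⟩ := h
  simp only [Fin.sum_univ_five] at h2
  obtain ⟨k0, e0⟩ := h1 0
  obtain ⟨k1, e1⟩ := h1 1
  obtain ⟨k2, e2⟩ := h1 2
  obtain ⟨k3, e3⟩ := h1 3
  obtain ⟨k4, e4⟩ := h1 4
  obtain ⟨m, e⟩ := h2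
  have r0 : (b 0 : ℝ) = a + 2 * k0 := by exact_mod_cast (by omega : b 0 = a + 2 * k0)
  have r1 : (b 1 : ℝ) = a + 2 * k1 := by exact_mod_cast (by omega : b 1 = a + 2 * k1)
  have r2 : (b 2 : ℝ) = a + 2 * k2 := by exact_mod_cast (by omega : b 2 = a + 2 * k2)
  have r3 : (b 3 : ℝ) = a + 2 * k3 := by exact_mod_cast (by omega : b 3 = a + 2 * k3)
  have r4 : (b 4 : ℝ) = a + 2 * k4 := by exact_mod_cast (by omega : b 4 = a + 2 * k4)
  have ra : (k0 + k1 + k2 + k3 + k4 : ℝ) = 2 * m - 2 * a := by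
    exact_mod_cast (by omega : k0 + k1 + k2 + k3 + k4 = 2 * m - 2 * a)
  -- The inverse of `glueBasis` in terms of b i = a + 2 k i. The condition modulo 4 makes the first
  -- coordinate integral.
  refine ⟨![a - m + k3 + k4, a + k2 + k4, k0 - k4, k1 - k4, k3 - k2, k4 - k3], ?_⟩
  rw [glueBasis_mulVec]
  ext i
  fin_cases i <;> simp [glueVec] <;> linarith

lemma formValue_conj (H P : Matrix (Fin 6) (Fin 6) ℝ) (x : Fin 6 → ℝ) :
    formValue (P.transpose * H * P) x = formValue H (P.mulVec x) := by
  simp only [formValue, ← Matrix.mulVec_mulVec, Matrix.dotProduct_mulVec,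
    Matrix.vecMul_transpose]

lemma posDef_conj {H P : Matrix (Fin 6) (Fin 6) ℝ} (hP : IsUnit P.det) (hH : H.PosDef) :
    (P.transpose * H * P).PosDef := by
  have h := hH.conjTranspose_mul_mul_same (B := P)
    (Matrix.mulVec_injective_iff_isUnit.mpr ((Matrix.isUnit_iff_isUnit_det P).mpr hP))
  simpa using h

lemma formValue_glueBasis_sub (H : Matrix (Fin 6) (Fin 6) ℝ) (x : Fin 6 → ℝ) (v : Fin 6 → ℤ) :
    formValue (glueBasis.transpose * H * glueBasis) (fun i => x i - (v i : ℝ)) =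
      formValue H (glueBasis.mulVec x - glueBasis.mulVec fun i => (v i : ℝ)) := by
  rw [formValue_conj, ← Matrix.mulVec_sub]
  rfl

lemma le_inhomMin_glue {H : Matrix (Fin 6) (Fin 6) ℝ} (hH : H.PosDef) {r : ℝ} (y : Fin 6 → ℝ)
    (hy : ∀ a b, IsGlue a b → r ≤ formValue H (y - glueVec a b)) :
    r ≤ inhomMin (glueBasis.transpose * H * glueBasis) := by
  have hB := glueBasis_isUnit_det
  refine le_ciSup_of_le (bddAbove_sqDistLattice (posDef_conj hB hH)) (glueBasis⁻¹.mulVec y)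
    (le_ciInf fun v => ?_)
  obtain ⟨a, b, hab, e⟩ := glueBasis_mulVec_intCast v
  rw [formValue_glueBasis_sub, Matrix.mulVec_mulVec, Matrix.mul_nonsing_inv _ hB,
    Matrix.one_mulVec, e]
  exact hy a b hab

lemma inhomMin_glue_le {H : Matrix (Fin 6) (Fin 6) ℝ} (hH : H.PosDef) {r : ℝ}
    (h : ∀ y, ∃ a b, IsGlue a b ∧ formValue H (y - glueVec a b) ≤ r) :
    inhomMin (glueBasis.transpose * H * glueBasis) ≤ r := by
  refine ciSup_le fun x => ?_
  obtain ⟨a, b, hab, hle⟩ := h (glueBasis.mulVec x)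
  obtain ⟨v, e⟩ := hab.exists_intCast
  refine (ciInf_le (bddBelow_formValue (posDef_conj glueBasis_isUnit_det hH) x) v).trans ?_
  rwa [formValue_glueBasis_sub, e]

/-- The diagonal form `β (u s² + |w|²)`. -/
def glueForm (u β : ℝ) : Matrix (Fin 6) (Fin 6) ℝ :=
  Matrix.diagonal ![β * u, β, β, β, β, β]

lemma formValue_glueForm (u β : ℝ) (y : Fin 6 → ℝ) :
    formValue (glueForm u β) y = β * (u * y 0 ^ 2 + ∑ i : Fin 5, y i.succ ^ 2) := by
  simp [formValue, glueForm, Matrix.mulVec_diagonal, dotProduct, Fin.sum_univ_succ]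
  ring

lemma glueForm_posDef {u β : ℝ} (hu : 0 < u) (hβ : 0 < β) : (glueForm u β).PosDef := by
  refine Matrix.PosDef.diagonal fun i => ?_
  fin_cases i <;> simp [hβ, hu]

lemma glueForm_det (u β : ℝ) : (glueForm u β).det = u * β ^ 6 := by
  simp [glueForm, Matrix.det_diagonal, Fin.prod_univ_succ]
  ring

lemma inhomMin_glueForm_le {u β : ℝ} (hβ : 0 < β) (hq : 231 * u ^ 2 - 70 * u - 13 = 0)
    (h1 : 0.433 < u) (h2 : u < 0.43301) :
    inhomMin (glueBasis.transpose * glueForm u β * glueBasis) ≤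
      β * ((21 * u ^ 2 - 14 * u + 13) / 4) := by
  refine inhomMin_glue_le (glueForm_posDef (by linarith) hβ) fun y => ?_
  obtain ⟨a, b, hab, h⟩ := covered hq h1 h2 (y 0) fun i => y i.succ
  refine ⟨a, b, hab, ?_⟩
  rw [formValue_glueForm]
  refine mul_le_mul_of_nonneg_left (le_trans (le_of_eq ?_) h) hβ.le
  simp [glueVec]

/-! ### The deep simplex is Delaunay, stably under perturbation -/

/-- The nonzero vertices, as rows, of a Delaunay simplex with a vertex at the origin. -/
noncomputable def deepVertex : Matrix (Fin 6) (Fin 6) ℝ :=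
  !![4, 0, 0, 0, 0, 0;
     2, 2, 0, 0, 0, 0;
     2, 0, 2, 0, 0, 0;
     2, 0, 0, 2, 0, 0;
     1, 1, 1, 1, 1, 1;
     3, 1, 1, 1, 1, -1]

/-- The barycentric coordinates with respect to `deepVertex`, as rows. -/
noncomputable def deepBary : Matrix (Fin 6) (Fin 6) ℝ :=
  !![1 / 4, -1 / 4, -1 / 4, -1 / 4, 1 / 4, 1 / 4;
     0, 1 / 2, 0, 0, -1 / 2, 0;
     0, 0, 1 / 2, 0, -1 / 2, 0;
     0, 0, 0, 1 / 2, -1 / 2, 0;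
     0, 0, 0, 0, 1 / 2, 1 / 2;
     0, 0, 0, 0, 1 / 2, -1 / 2]

/-- The quadratic function of `y`, linear in `H`, that vanishes at the origin and at all vertices
in `deepVertex` and has the same quadratic part as `H`. -/
noncomputable def deepDefect (H : Matrix (Fin 6) (Fin 6) ℝ) (y : Fin 6 → ℝ) : ℝ :=
  formValue H y - ∑ i, deepBary.mulVec y i * formValue H (deepVertex i)

lemma deepBary_mul_deepVertex : deepBary * deepVertex.transpose = 1 := by
  ext i j
  fin_cases i <;> fin_cases j <;>
    simp [deepBary, deepVertex, Matrix.mul_apply, Fin.sum_univ_succ] <;> norm_num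

lemma deepDefect_zero (H : Matrix (Fin 6) (Fin 6) ℝ) : deepDefect H 0 = 0 := by
  simp [deepDefect, formValue]

lemma deepDefect_deepVertex (H : Matrix (Fin 6) (Fin 6) ℝ) (i : Fin 6) :
    deepDefect H (deepVertex i) = 0 := by
  have h : ∀ j, deepBary.mulVec (deepVertex i) j = if j = i then 1 else 0 := fun j => by
    have := congrFun (congrFun deepBary_mul_deepVertex j) i
    simpa [Matrix.mul_apply, Matrix.mulVec, dotProduct, Matrix.one_apply] using this
  simp [deepDefect, h]

/-- If the simplex is a Delaunay simplex of `H` then its circumradius, and so every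
value of minus the defect, is a lower bound of the inhomogeneous minimum. -/
lemma neg_deepDefect_le_inhomMin {H : Matrix (Fin 6) (Fin 6) ℝ} (hH : H.PosDef)
    (h : ∀ a b, IsGlue a b → 0 ≤ deepDefect H (glueVec a b)) (z : Fin 6 → ℝ) :
    -deepDefect H z ≤ inhomMin (glueBasis.transpose * H * glueBasis) := by
  have hsymm : H.transpose = H := by simpa using hH.isHermitian.eq
  have hdet : IsUnit H.det := hH.det_pos.ne'.isUnit
  set k : Fin 6 → ℝ := fun i => formValue H (deepVertex i) with hk
  -- The circumcentre: 2Hc is the gradient of the linear function that takes the value H[v] at each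
  -- vertex v.
  set c : Fin 6 → ℝ := H⁻¹.mulVec ((1 / 2 : ℝ) • deepBary.transpose.mulVec k) with hc
  have hHc : H.mulVec c = (1 / 2 : ℝ) • deepBary.transpose.mulVec k := by
    rw [hc, Matrix.mulVec_mulVec, Matrix.mul_nonsing_inv _ hdet, Matrix.one_mulVec]
  have key : ∀ y, formValue H (c - y) = formValue H c + deepDefect H y := by
    intro y
    have e1 : c ⬝ᵥ H.mulVec y = y ⬝ᵥ H.mulVec c := by
      rw [Matrix.dotProduct_mulVec, ← Matrix.mulVec_transpose, hsymm, dotProduct_comm]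
    have e2 : y ⬝ᵥ H.mulVec c = (1 / 2) * ∑ i, deepBary.mulVec y i * k i := by
      rw [hHc, dotProduct_smul, Matrix.dotProduct_mulVec, Matrix.vecMul_transpose, smul_eq_mul]
      rfl
    simp only [formValue, deepDefect, Matrix.mulVec_sub, sub_dotProduct, dotProduct_sub] at *
    rw [e1, e2]
    simp only [hk]
    ring
  refine le_trans ?_ (le_inhomMin_glue hH c (r := formValue H c) fun a b hab => ?_)
  -- H[c] = H[c - z] - `deepDefect H z`, and the first term on the right is nonnegative.
  · linarith [key z, formValue_nonneg hH (c - z)]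
  · linarith [key (glueVec a b), h a b hab]

lemma deepDefect_glueForm (u β : ℝ) (y : Fin 6 → ℝ) :
    deepDefect (glueForm u β) y =
      β * (u * ((y 0 - 2) ^ 2 - 4 + 2 * (y 1 + y 2 + y 3) - 3 * y 4) +
        (y 1 ^ 2 + y 2 ^ 2 + y 3 ^ 2 + y 4 ^ 2 + y 5 ^ 2 - 2 * (y 1 + y 2 + y 3) + y 4)) := by
  simp only [deepDefect, formValue_glueForm, Fin.sum_univ_five, Fin.sum_univ_six]
  simp [deepBary, deepVertex, Matrix.mulVec, dotProduct, Fin.sum_univ_six]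
  ring

/-- The defect at a = 2m + 2, b i = 2 k i splits into one-variable terms. All are nonnegative except
the first, which is at least -4u, so few integers survive; parity and the bound remove all but the
vertices. -/
lemma half_le_of_even {u : ℝ} (h1 : 0.433 < u) (h2 : u < 0.43301) {m k0 k1 k2 k3 k4 : ℤ}
    (hp : 2 ∣ k0 + k1 + k2 + k3 + k4 + m + 1)
    (hlt : 4 * u * (m ^ 2 - 1) + 4 * k0 * (k0 - 1 + u) + 4 * k1 * (k1 - 1 + u) +
      4 * k2 * (k2 - 1 + u) + 2 * k3 * (2 * k3 + 1 - 3 * u) + 4 * k4 ^ 2 < 1 / 2) :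
    k3 = 0 ∧ k4 = 0 ∧
      (((m = 1 ∨ m = -1) ∧ k0 = 0 ∧ k1 = 0 ∧ k2 = 0) ∨
        (m = 0 ∧ ((k0 = 1 ∧ k1 = 0 ∧ k2 = 0) ∨ (k0 = 0 ∧ k1 = 1 ∧ k2 = 0) ∨
          (k0 = 0 ∧ k1 = 0 ∧ k2 = 1)))) := by
  have tri : ∀ k : ℤ, (k : ℝ) ≤ -1 ∨ k = 0 ∨ k = 1 ∨ (2 : ℝ) ≤ k := by
    intro k
    rcases (by omega : k ≤ -1 ∨ k = 0 ∨ k = 1 ∨ 2 ≤ k) with h | h | h | h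
    · left; exact_mod_cast h
    · simp [h]
    · simp [h]
    · right; right; right; exact_mod_cast h
  have g : ∀ k : ℤ, (k = 0 ∨ k = 1) ∨ 4 ≤ 4 * (k : ℝ) * (k - 1 + u) := by
    intro k
    rcases tri k with h | h | h | h
    · right; nlinarith
    · left; left; exact h
    · left; right; exact h
    · right; nlinarith
  have g0 : ∀ k : ℤ, 0 ≤ 4 * (k : ℝ) * (k - 1 + u) := by
    intro k
    rcases g k with (h | h) | h
    · simp [h]
    · simp [h]; linarith
    · linarith
  have g3 : k3 = 0 ∨ 3 ≤ 2 * (k3 : ℝ) * (2 * k3 + 1 - 3 * u) := by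
    rcases tri k3 with h | h | h | h
    · right; nlinarith
    · left; exact h
    · right; rw [h]; norm_num; linarith
    · right; nlinarith
  have g30 : 0 ≤ 2 * (k3 : ℝ) * (2 * k3 + 1 - 3 * u) := by
    rcases g3 with h | h
    · simp [h]
    · linarith
  have g4 : k4 = 0 ∨ (4 : ℝ) ≤ 4 * (k4 : ℝ) ^ 2 := by
    rcases tri k4 with h | h | h | h
    · right; nlinarith
    · left; exact h
    · right; rw [h]; norm_num
    · right; nlinarith
  have g40 : (0 : ℝ) ≤ 4 * (k4 : ℝ) ^ 2 := by positivity
  have gm : (m = 0 ∨ m = 1 ∨ m = -1) ∨ 12 * u ≤ 4 * u * ((m : ℝ) ^ 2 - 1) := by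
    rcases (by omega : (m = 0 ∨ m = 1 ∨ m = -1) ∨ m ≤ -2 ∨ 2 ≤ m) with h | h | h
    · left; exact h
    · have h : (m : ℝ) ≤ -2 := by exact_mod_cast h
      right; nlinarith [mul_nonneg (by linarith : (0 : ℝ) ≤ u) (by nlinarith : (0:ℝ) ≤ m ^ 2 - 4)]
    · have h : (2 : ℝ) ≤ m := by exact_mod_cast h
      right; nlinarith [mul_nonneg (by linarith : (0 : ℝ) ≤ u) (by nlinarith : (0:ℝ) ≤ m ^ 2 - 4)]
  have gm0 : -4 * u ≤ 4 * u * ((m : ℝ) ^ 2 - 1) := by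
    nlinarith [mul_nonneg (by linarith : (0 : ℝ) ≤ u) (sq_nonneg (m : ℝ))]
  have e3 : k3 = 0 := g3.resolve_right fun h => by linarith [g0 k0, g0 k1, g0 k2]
  have e4 : k4 = 0 := g4.resolve_right fun h => by linarith [g0 k0, g0 k1, g0 k2]
  have f0 := (g k0).resolve_right fun h => by linarith [g0 k1, g0 k2]
  have f1 := (g k1).resolve_right fun h => by linarith [g0 k0, g0 k2]
  have f2 := (g k2).resolve_right fun h => by linarith [g0 k0, g0 k1]
  have fm := gm.resolve_right fun h => by linarith [g0 k0, g0 k1, g0 k2]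
  refine ⟨e3, e4, ?_⟩
  subst e3 e4
  rcases f0 with rfl | rfl <;> rcases f1 with rfl | rfl <;> rcases f2 with rfl | rfl <;>
    rcases fm with rfl | rfl | rfl <;> first
      | (exfalso; omega)
      | (exfalso; norm_num at hlt; linarith)
      | simp

/-- Same separation at a = 2m + 3, b i = 2 k i + 1; here every term is nonnegative. -/
lemma half_le_of_odd {u : ℝ} (h1 : 0.433 < u) (h2 : u < 0.43301) {m k0 k1 k2 k3 k4 : ℤ}
    (hp : 2 ∣ k0 + k1 + k2 + k3 + k4 + m + 1)
    (hlt : 4 * u * (m * (m + 1)) + 4 * k0 * (k0 + u) + 4 * k1 * (k1 + u) +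
      4 * k2 * (k2 + u) + k3 * (4 * k3 + 6 - 6 * u) + 4 * (k4 * (k4 + 1)) < 1 / 2) :
    k0 = 0 ∧ k1 = 0 ∧ k2 = 0 ∧ k3 = 0 ∧ ((m = 0 ∧ k4 = -1) ∨ (m = -1 ∧ k4 = 0)) := by
  have tri : ∀ k : ℤ, (k : ℝ) ≤ -2 ∨ k = -1 ∨ k = 0 ∨ (1 : ℝ) ≤ k := by
    intro k
    rcases (by omega : k ≤ -2 ∨ k = -1 ∨ k = 0 ∨ 1 ≤ k) with h | h | h | h
    · left; exact_mod_cast h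
    · simp [h]
    · simp [h]
    · right; right; right; exact_mod_cast h
  have g : ∀ k : ℤ, k = 0 ∨ 1 ≤ 4 * (k : ℝ) * (k + u) := by
    intro k
    rcases tri k with h | h | h | h
    · right; nlinarith
    · right; rw [h]; norm_num; linarith
    · left; exact h
    · right; nlinarith
  have g0 : ∀ k : ℤ, 0 ≤ 4 * (k : ℝ) * (k + u) := by
    intro k
    rcases g k with h | h
    · simp [h]
    · linarith
  have g3 : k3 = 0 ∨ 1 / 2 ≤ (k3 : ℝ) * (4 * k3 + 6 - 6 * u) := by
    rcases tri k3 with h | h | h | h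
    · right; nlinarith
    -- The tightest case, k3 = -1, has value 6u - 2 > 0.59; this is what limits the margin to 1/2.
    · right; rw [h]; norm_num; linarith
    · left; exact h
    · right; nlinarith
  have g30 : 0 ≤ (k3 : ℝ) * (4 * k3 + 6 - 6 * u) := by
    rcases g3 with h | h
    · simp [h]
    · linarith
  have q : ∀ k : ℤ, (k = 0 ∨ k = -1) ∨ 2 ≤ (k : ℝ) * (k + 1) := by
    intro k
    rcases tri k with h | h | h | h
    · right; nlinarith
    · left; right; exact h
    · left; left; exact h
    · right; nlinarith
  have q0 : ∀ k : ℤ, 0 ≤ (k : ℝ) * (k + 1) := by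
    intro k
    rcases q k with (h | h) | h
    · simp [h]
    · simp [h]
    · linarith
  have qm : 0 ≤ 4 * u * ((m : ℝ) * (m + 1)) := mul_nonneg (by linarith) (q0 m)
  have e0 : k0 = 0 := (g k0).resolve_right fun h => by linarith [g0 k1, g0 k2, q0 k4]
  have e1 : k1 = 0 := (g k1).resolve_right fun h => by linarith [g0 k0, g0 k2, q0 k4]
  have e2 : k2 = 0 := (g k2).resolve_right fun h => by linarith [g0 k0, g0 k1, q0 k4]
  have e3 : k3 = 0 := g3.resolve_right fun h => by linarith [g0 k0, g0 k1, g0 k2, q0 k4]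
  have f4 := (q k4).resolve_right fun h => by linarith [g0 k0, g0 k1, g0 k2]
  have fm := (q m).resolve_right fun h => by nlinarith [g0 k0, g0 k1, g0 k2, q0 k4]
  exact ⟨e0, e1, e2, e3, by omega⟩

/-- A lattice vector is a vertex of the simplex or has a defect bounded away from zero. -/
lemma IsGlue.deepDefect_cases {u : ℝ} (h1 : 0.433 < u) (h2 : u < 0.43301) {a : ℤ}
    {b : Fin 5 → ℤ} (h : IsGlue a b) :
    (glueVec a b = 0 ∨ ∃ i, glueVec a b = deepVertex i) ∨
      1 / 2 ≤ deepDefect (glueForm u 1) (glueVec a b) := by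
  obtain ⟨hb, hs⟩ := h
  rw [or_iff_not_imp_right, not_le, deepDefect_glueForm]
  intro hlt
  have hb0 := hb 0
  have hb1 := hb 1
  have hb2 := hb 2
  have hb3 := hb 3
  have hb4 := hb 4
  rw [Fin.sum_univ_five] at hs
  have ext6 : ∀ y z : Fin 6 → ℝ, y 0 = z 0 → y 1 = z 1 → y 2 = z 2 → y 3 = z 3 → y 4 = z 4 →
      y 5 = z 5 → y = z := by
    intro y z _ _ _ _ _ _
    ext j
    fin_cases j <;> assumption
  have v0 : glueVec a b 0 = a := rfl
  have v1 : glueVec a b 1 = b 0 := rfl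
  have v2 : glueVec a b 2 = b 1 := rfl
  have v3 : glueVec a b 3 = b 2 := rfl
  have v4 : glueVec a b 4 = b 3 := rfl
  have v5 : glueVec a b 5 = b 4 := rfl
  rw [v0, v1, v2, v3, v4, v5] at hlt
  generalize b 0 = b0, b 1 = b1, b 2 = b2, b 3 = b3, b 4 = b4 at *
  rcases Int.even_or_odd' a with ⟨m, rfl | rfl⟩
  · obtain ⟨k0, rfl⟩ : ∃ k, b0 = 2 * k := ⟨b0 / 2, by omega⟩
    obtain ⟨k1, rfl⟩ : ∃ k, b1 = 2 * k := ⟨b1 / 2, by omega⟩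
    obtain ⟨k2, rfl⟩ : ∃ k, b2 = 2 * k := ⟨b2 / 2, by omega⟩
    obtain ⟨k3, rfl⟩ : ∃ k, b3 = 2 * k := ⟨b3 / 2, by omega⟩
    obtain ⟨k4, rfl⟩ : ∃ k, b4 = 2 * k := ⟨b4 / 2, by omega⟩
    obtain ⟨e3, e4, h⟩ := half_le_of_even (m := m - 1) (k0 := k0) (k1 := k1) (k2 := k2)
      (k3 := k3) (k4 := k4) h1 h2 (by omega)
      (lt_of_eq_of_lt (by push_cast; ring) hlt)
    rcases h with ⟨hm | hm, e0, e1, e2⟩ | ⟨hm, ⟨e0, e1, e2⟩ | ⟨e0, e1, e2⟩ | ⟨e0, e1, e2⟩⟩ <;>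
      obtain rfl := eq_add_of_sub_eq hm <;> subst e0 e1 e2 e3 e4
    · right; refine ⟨0, ext6 _ _ (v0.trans ?_) (v1.trans ?_) (v2.trans ?_)
        (v3.trans ?_) (v4.trans ?_) (v5.trans ?_)⟩ <;> simp [deepVertex]
    · left; refine ext6 _ _ (v0.trans ?_) (v1.trans ?_) (v2.trans ?_)
        (v3.trans ?_) (v4.trans ?_) (v5.trans ?_) <;> norm_num
    · right; refine ⟨1, ext6 _ _ (v0.trans ?_) (v1.trans ?_) (v2.trans ?_)
        (v3.trans ?_) (v4.trans ?_) (v5.trans ?_)⟩ <;> simp [deepVertex]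
    · right; refine ⟨2, ext6 _ _ (v0.trans ?_) (v1.trans ?_) (v2.trans ?_)
        (v3.trans ?_) (v4.trans ?_) (v5.trans ?_)⟩ <;> simp [deepVertex]
    · right; refine ⟨3, ext6 _ _ (v0.trans ?_) (v1.trans ?_) (v2.trans ?_)
        (v3.trans ?_) (v4.trans ?_) (v5.trans ?_)⟩ <;> simp [deepVertex]
  · obtain ⟨k0, rfl⟩ : ∃ k, b0 = 2 * k + 1 := ⟨b0 / 2, by omega⟩
    obtain ⟨k1, rfl⟩ : ∃ k, b1 = 2 * k + 1 := ⟨b1 / 2, by omega⟩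
    obtain ⟨k2, rfl⟩ : ∃ k, b2 = 2 * k + 1 := ⟨b2 / 2, by omega⟩
    obtain ⟨k3, rfl⟩ : ∃ k, b3 = 2 * k + 1 := ⟨b3 / 2, by omega⟩
    obtain ⟨k4, rfl⟩ : ∃ k, b4 = 2 * k + 1 := ⟨b4 / 2, by omega⟩
    obtain ⟨e0, e1, e2, e3, h⟩ := half_le_of_odd (m := m - 1) (k0 := k0) (k1 := k1) (k2 := k2)
      (k3 := k3) (k4 := k4) h1 h2 (by omega)
      (lt_of_eq_of_lt (by push_cast; ring) hlt)
    rcases h with ⟨hm, e4⟩ | ⟨hm, e4⟩ <;>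
      obtain rfl := eq_add_of_sub_eq hm <;> subst e0 e1 e2 e3 e4
    · right; refine ⟨5, ext6 _ _ (v0.trans ?_) (v1.trans ?_) (v2.trans ?_)
        (v3.trans ?_) (v4.trans ?_) (v5.trans ?_)⟩ <;> simp [deepVertex]
    · right; refine ⟨4, ext6 _ _ (v0.trans ?_) (v1.trans ?_) (v2.trans ?_)
        (v3.trans ?_) (v4.trans ?_) (v5.trans ?_)⟩ <;> simp [deepVertex]

lemma formValue_eq_sum (H : Matrix (Fin 6) (Fin 6) ℝ) (y : Fin 6 → ℝ) :
    formValue H y = ∑ i, ∑ j, y i * y j * H i j := by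
  simp only [formValue, dotProduct, Matrix.mulVec, Finset.mul_sum]
  exact Finset.sum_congr rfl fun i _ => Finset.sum_congr rfl fun j _ => by ring

lemma abs_formValue_le {E : Matrix (Fin 6) (Fin 6) ℝ} {ε : ℝ} (hE : ∀ i j, |E i j| ≤ ε)
    (y : Fin 6 → ℝ) : |formValue E y| ≤ ε * (∑ i, |y i|) ^ 2 := by
  rw [formValue_eq_sum, sq, Finset.sum_mul_sum, Finset.mul_sum]
  refine (Finset.abs_sum_le_sum_abs _ _).trans (Finset.sum_le_sum fun i _ => ?_)
  rw [Finset.mul_sum]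
  refine (Finset.abs_sum_le_sum_abs _ _).trans (Finset.sum_le_sum fun j _ => ?_)
  rw [abs_mul, abs_mul, mul_comm]
  exact mul_le_mul_of_nonneg_right (hE i j) (by positivity)

/-- The entries of `deepBary` are at most 1 in absolute value and each vertex has ℓ¹ norm at most 8,
whence 384 = 6 · 8². -/
lemma abs_deepDefect_le {E : Matrix (Fin 6) (Fin 6) ℝ} {ε : ℝ} (hε : 0 ≤ ε)
    (hE : ∀ i j, |E i j| ≤ ε) (y : Fin 6 → ℝ) :
    |deepDefect E y| ≤ ε * ((∑ i, |y i|) ^ 2 + 384 * ∑ i, |y i|) := by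
  set T := ∑ i, |y i| with hT
  have hT0 : 0 ≤ T := Finset.sum_nonneg fun i _ => abs_nonneg _
  have hB : ∀ i, |deepBary.mulVec y i| ≤ T := by
    intro i
    simp only [Matrix.mulVec, dotProduct]
    refine (Finset.abs_sum_le_sum_abs _ _).trans (Finset.sum_le_sum fun j _ => ?_)
    rw [abs_mul]
    refine mul_le_of_le_one_left (abs_nonneg _) ?_
    fin_cases i <;> fin_cases j <;> simp [deepBary, abs_le] <;> norm_num
  have hV : ∀ i, |formValue E (deepVertex i)| ≤ ε * 64 := by
    intro i
    refine (abs_formValue_le hE _).trans (mul_le_mul_of_nonneg_left ?_ hε)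
    have : ∑ j, |deepVertex i j| ≤ 8 := by
      fin_cases i <;> simp [deepVertex, Fin.sum_univ_six] <;> norm_num
    have h0 : 0 ≤ ∑ j, |deepVertex i j| := Finset.sum_nonneg fun i _ => abs_nonneg _
    nlinarith
  have hS : |∑ i, deepBary.mulVec y i * formValue E (deepVertex i)| ≤ 6 * (T * (ε * 64)) := by
    refine (Finset.abs_sum_le_sum_abs _ _).trans ?_
    calc _ ≤ ∑ _i : Fin 6, T * (ε * 64) := Finset.sum_le_sum fun i _ => by
          rw [abs_mul]
          exact mul_le_mul (hB i) (hV i) (abs_nonneg _) hT0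
      _ = 6 * (T * (ε * 64)) := by simp
  have := abs_formValue_le hE y
  refine (abs_sub _ _).trans ?_
  linarith

lemma deepDefect_sub (H K : Matrix (Fin 6) (Fin 6) ℝ) (y : Fin 6 → ℝ) :
    deepDefect (H - K) y = deepDefect H y - deepDefect K y := by
  have h : ∀ z, formValue (H - K) z = formValue H z - formValue K z := by
    intro z
    simp only [formValue, Matrix.sub_mulVec, dotProduct_sub]
  simp only [deepDefect, h, mul_sub, Finset.sum_sub_distrib]
  ring

/-- The defect grows quadratically and is bounded away from zero off the vertices, so it dominates
the perturbation error uniformly over the infinite lattice. -/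
lemma sum_abs_le_deepDefect {u : ℝ} (h1 : 0.433 < u) (h2 : u < 0.43301) {y : Fin 6 → ℝ}
    (hy : 1 / 2 ≤ deepDefect (glueForm u 1) y) :
    (∑ i, |y i|) ^ 2 + 384 * ∑ i, |y i| ≤ 100000 * deepDefect (glueForm u 1) y := by
  set T := ∑ i, |y i| with hT
  have hN : T ^ 2 ≤ 6 * ∑ i, y i ^ 2 := by
    have := sq_sum_le_card_mul_sum_sq (s := Finset.univ) (f := fun i => |y i|)
    simpa using this
  have hD : ∑ i, y i ^ 2 ≤ 4 * deepDefect (glueForm u 1) y + 24 := by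
    rw [deepDefect_glueForm, Fin.sum_univ_six]
    have f : ∀ x : ℝ, x ^ 2 ≤ 4 * (x ^ 2 - 2 * x + u * (2 * x)) + 2 := fun x => by
      nlinarith [sq_nonneg (x - 4 / 5), mul_nonneg (sub_nonneg.mpr h1.le) (sq_nonneg (x + 1)),
        mul_nonneg (sub_nonneg.mpr h2.le) (sq_nonneg (x + 1)), sq_nonneg x]
    have g : y 4 ^ 2 ≤ 4 * (y 4 ^ 2 + y 4 - 3 * u * y 4) + 1 := by
      nlinarith [sq_nonneg (y 4 - 1 / 2), sq_nonneg (y 4 + 1),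
        mul_nonneg (sub_nonneg.mpr h1.le) (sq_nonneg (y 4 - 1)),
        mul_nonneg (sub_nonneg.mpr h2.le) (sq_nonneg (y 4 + 1)), sq_nonneg (y 4)]
    have h : y 0 ^ 2 ≤ 4 * (u * ((y 0 - 2) ^ 2 - 4)) + 17 := by
      nlinarith [sq_nonneg (y 0 - 5), mul_nonneg (sub_nonneg.mpr h1.le) (sq_nonneg (y 0 - 2))]
    nlinarith [f (y 1), f (y 2), f (y 3), sq_nonneg (y 5)]
  nlinarith [sq_nonneg (T - 1)]

/-- The simplex remains a Delaunay simplex under small perturbations of the form. -/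
lemma deepDefect_nonneg_of_near {u β : ℝ} (h1 : 0.433 < u) (h2 : u < 0.43301) (hβ : 1 ≤ β)
    {H : Matrix (Fin 6) (Fin 6) ℝ} (hH : ∀ i j, |H i j - glueForm u β i j| ≤ 1 / 100000)
    {a : ℤ} {b : Fin 5 → ℤ} (h : IsGlue a b) : 0 ≤ deepDefect H (glueVec a b) := by
  rcases h.deepDefect_cases h1 h2 with (h | ⟨i, h⟩) | h
  · rw [h, deepDefect_zero]
  · rw [h, deepDefect_deepVertex]
  · have e1 := abs_deepDefect_le (E := H - glueForm u β) (by norm_num : (0 : ℝ) ≤ 1 / 100000)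
      (fun i j => hH i j) (glueVec a b)
    have e2 := sum_abs_le_deepDefect h1 h2 h
    have e3 : deepDefect (glueForm u β) (glueVec a b) =
        β * deepDefect (glueForm u 1) (glueVec a b) := by
      rw [deepDefect_glueForm, deepDefect_glueForm, one_mul]
    rw [deepDefect_sub, e3] at e1
    have := (abs_le.mp e1).1
    nlinarith

/-! ### Linear lower bounds and averaging over symmetries -/

lemma formValue_submatrix (H : Matrix (Fin 6) (Fin 6) ℝ) (τ : Equiv.Perm (Fin 6))
    (y : Fin 6 → ℝ) : formValue (H.submatrix τ τ) y = formValue H (y ∘ τ.symm) := by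
  rw [formValue_eq_sum, formValue_eq_sum]
  symm
  rw [← Equiv.sum_comp τ]
  refine Finset.sum_congr rfl fun i _ => ?_
  rw [← Equiv.sum_comp τ]
  simp

/-- Signed permutations that preserve the glue lattice do not increase the inhomogeneous
minimum. -/
lemma inhomMin_signedPerm_le {H : Matrix (Fin 6) (Fin 6) ℝ} (hH : H.PosDef)
    (τ : Equiv.Perm (Fin 6)) (e : Fin 6 → ℝ) (he : ∀ i, e i ^ 2 = 1)
    (hG : ∀ a b, IsGlue a b → ∃ a' b', IsGlue a' b' ∧
      ∀ i, glueVec a b (τ i) = e i * glueVec a' b' i) :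
    ((Matrix.diagonal e).transpose * H.submatrix τ τ * Matrix.diagonal e).PosDef ∧
    inhomMin (glueBasis.transpose * ((Matrix.diagonal e).transpose * H.submatrix τ τ *
      Matrix.diagonal e) * glueBasis) ≤ inhomMin (glueBasis.transpose * H * glueBasis) := by
  have hdet : IsUnit (Matrix.diagonal e).det := by
    rw [Matrix.det_diagonal, isUnit_iff_ne_zero, Finset.prod_ne_zero_iff]
    intro i _ h
    simpa [h] using he i
  have hpd := posDef_conj hdet (hH.submatrix τ.injective)
  refine ⟨hpd, ciSup_le fun x => ?_⟩
  refine le_inhomMin_glue hH (fun k => e (τ.symm k) * glueBasis.mulVec x (τ.symm k))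
    fun a b hab => ?_
  obtain ⟨a', b', hab', h⟩ := hG a b hab
  obtain ⟨v, hv⟩ := hab'.exists_intCast
  refine (ciInf_le (bddBelow_formValue (posDef_conj glueBasis_isUnit_det hpd) x) v).trans
    (le_of_eq ?_)
  rw [formValue_glueBasis_sub, hv, formValue_conj, formValue_submatrix]
  congr 1
  ext k
  have hk := h (τ.symm k)
  rw [Equiv.apply_symm_apply] at hk
  simp only [Function.comp_apply, Matrix.mulVec_diagonal, Pi.sub_apply, hk]
  ring

/-- The linear form with coefficients `m` bounds the inhomogeneous minimum from below on a
neighbourhood of `glueForm u β`. -/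
def IsLowerBound (u β : ℝ) (m : Matrix (Fin 6) (Fin 6) ℝ) : Prop :=
  ∀ H : Matrix (Fin 6) (Fin 6) ℝ, H.PosDef → (∀ i j, |H i j - glueForm u β i j| ≤ 1 / 100000) →
    ∑ i, ∑ j, m i j * H i j ≤ inhomMin (glueBasis.transpose * H * glueBasis)

lemma isLowerBound_deep {u β : ℝ} (h1 : 0.433 < u) (h2 : u < 0.43301) (hβ : 1 ≤ β)
    (z : Fin 6 → ℝ) : IsLowerBound u β (Matrix.of fun i j =>
      (∑ k, deepBary.mulVec z k * (deepVertex k i * deepVertex k j)) - z i * z j) := by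
  intro H hH hnear
  refine le_trans (le_of_eq ?_) (neg_deepDefect_le_inhomMin hH
    (fun a b hab => deepDefect_nonneg_of_near h1 h2 hβ hnear hab) z)
  have h : ∑ k, deepBary.mulVec z k * ∑ i, ∑ j, deepVertex k i * deepVertex k j * H i j =
      ∑ i, ∑ j, (∑ k, deepBary.mulVec z k * (deepVertex k i * deepVertex k j)) * H i j := by
    simp_rw [Finset.mul_sum, Finset.sum_mul]
    rw [Finset.sum_comm]
    refine Finset.sum_congr rfl fun i _ => ?_
    rw [Finset.sum_comm]
    exact Finset.sum_congr rfl fun j _ => Finset.sum_congr rfl fun k _ => by ring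
  simp only [deepDefect, formValue_eq_sum, Matrix.of_apply, sub_mul, Finset.sum_sub_distrib,
    neg_sub, h]

lemma IsLowerBound.signedPerm {u β : ℝ} {m : Matrix (Fin 6) (Fin 6) ℝ} (hm : IsLowerBound u β m)
    (τ : Equiv.Perm (Fin 6)) (e : Fin 6 → ℝ) (he : ∀ i, e i ^ 2 = 1)
    (hG : ∀ a b, IsGlue a b → ∃ a' b', IsGlue a' b' ∧
      ∀ i, glueVec a b (τ i) = e i * glueVec a' b' i)
    (hτ : ∀ i j, e i * e j * glueForm u β (τ i) (τ j) = glueForm u β i j)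
    {H : Matrix (Fin 6) (Fin 6) ℝ} (hH : H.PosDef)
    (hnear : ∀ i j, |H i j - glueForm u β i j| ≤ 1 / 100000) :
    ∑ i, ∑ j, m i j * (e i * e j * H (τ i) (τ j)) ≤
      inhomMin (glueBasis.transpose * H * glueBasis) := by
  obtain ⟨hpd, hle⟩ := inhomMin_signedPerm_le hH τ e he hG
  have key : ∀ i j, ((Matrix.diagonal e).transpose * H.submatrix τ τ * Matrix.diagonal e) i j =
      e i * e j * H (τ i) (τ j) := by
    intro i j
    rw [Matrix.diagonal_transpose, Matrix.mul_diagonal, Matrix.diagonal_mul]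
    simp only [Matrix.submatrix_apply]
    ring
  have habs : ∀ i, |e i| = 1 := fun i => by
    rw [← Real.sqrt_sq_eq_abs, he i, Real.sqrt_one]
  refine le_trans (le_of_eq ?_) ((hm _ hpd fun i j => ?_).trans hle)
  · simp only [key]
  · rw [key, ← hτ, ← mul_sub, abs_mul, abs_mul, habs, habs, one_mul, one_mul]
    exact hnear _ _

/-- Average of the bound at `H` and at its conjugate by the sign change `e`. An even number of flips
leaves `a` unchanged. -/
lemma IsLowerBound.signs {u β : ℝ} {m : Matrix (Fin 6) (Fin 6) ℝ} (hm : IsLowerBound u β m)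
    (e : Fin 6 → ℤ) (h0 : e 0 = 1) (he : ∀ i : Fin 5, e i.succ = 1 ∨ e i.succ = -1)
    (hprod : ∏ i : Fin 5, e i.succ = 1) :
    IsLowerBound u β (Matrix.of fun i j => m i j * ((1 + e i * e j) / 2)) := by
  intro H hH hnear
  have hsq : ∀ i, (e i : ℝ) ^ 2 = 1 := by
    intro i
    refine Fin.cases (by simp [h0]) (fun k => ?_) i
    rcases he k with h | h <;> simp [h]
  have key := hm.signedPerm (Equiv.refl _) (fun i => e i) hsq (fun a b hab => by
    refine ⟨a, fun i => e i.succ * b i, by simpa [hprod] using hab.sign _ he, fun i => ?_⟩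
    refine Fin.cases (by simp [h0, glueVec]) (fun k => ?_) i
    rcases he k with h | h <;> simp [glueVec, h]) (fun i j => by
    by_cases hij : i = j
    · subst hij
      rw [← sq, hsq, one_mul, Equiv.refl_apply]
    · simp [glueForm, hij]) hH hnear
  have := hm H hH hnear
  simp only [Equiv.refl_apply] at key
  have havg : ∑ i, ∑ j, Matrix.of (fun i j => m i j * ((1 + (e i : ℝ) * e j) / 2)) i j * H i j =
      (∑ i, ∑ j, m i j * H i j + ∑ i, ∑ j, m i j * (e i * e j * H i j)) / 2 := by
    rw [← Finset.sum_add_distrib, Finset.sum_div]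
    refine Finset.sum_congr rfl fun i _ => ?_
    rw [← Finset.sum_add_distrib, Finset.sum_div]
    refine Finset.sum_congr rfl fun j _ => ?_
    rw [Matrix.of_apply]
    ring
  rw [havg]
  linarith

/-- Four adjacent double flips separate every pair of distinct indices, so all off-diagonal
coefficients average to zero. -/
lemma IsLowerBound.diagonal {u β : ℝ} {m : Matrix (Fin 6) (Fin 6) ℝ}
    (hm : IsLowerBound u β m) : IsLowerBound u β (Matrix.diagonal fun i => m i i) := by
  have h := (((hm.signs ![1, -1, -1, 1, 1, 1] rfl (by decide) (by decide)).signs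
    ![1, 1, -1, -1, 1, 1] rfl (by decide) (by decide)).signs
    ![1, 1, 1, -1, -1, 1] rfl (by decide) (by decide)).signs
    ![1, 1, 1, 1, -1, -1] rfl (by decide) (by decide)
  convert h using 1
  ext i j
  fin_cases i <;> fin_cases j <;> simp

lemma IsLowerBound.perm {u β : ℝ} {d : Fin 6 → ℝ} (hd : IsLowerBound u β (Matrix.diagonal d))
    (σ : Equiv.Perm (Fin 5)) {H : Matrix (Fin 6) (Fin 6) ℝ} (hH : H.PosDef)
    (hnear : ∀ i j, |H i j - glueForm u β i j| ≤ 1 / 100000) :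
    d 0 * H 0 0 + ∑ k : Fin 5, d k.succ * H (σ k).succ (σ k).succ ≤
      inhomMin (glueBasis.transpose * H * glueBasis) := by
  have hconst : ∀ k : Fin 5, ![β, β, β, β, β] k = β := by
    intro k
    fin_cases k <;> rfl
  have h := hd.signedPerm (Equiv.Perm.decomposeFin.symm (0, σ)) 1 (by simp) (fun a b hab => by
    refine ⟨a, b ∘ σ, hab.perm σ, fun i => ?_⟩
    refine Fin.cases (by simp [glueVec]) (fun k => ?_) i
    simp [glueVec]) (fun i j => by
    refine Fin.cases ?_ (fun k => ?_) i <;> refine Fin.cases ?_ (fun l => ?_) j <;>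
      simp [glueForm, Matrix.diagonal_apply, hconst,
        (Fin.succ_ne_zero _).symm]) hH hnear
  simpa [Matrix.diagonal_apply, Fin.sum_univ_succ] using h

/-! ### Arithmetic-geometric mean inequality and local optimality -/

/-- The arithmetic-geometric mean inequality for the eigenvalues of a positive definite matrix. -/
lemma det_le_trace_div_pow {n : ℕ} (hn : n ≠ 0) {A : Matrix (Fin n) (Fin n) ℝ} (hA : A.PosDef) :
    A.det ≤ (A.trace / n) ^ n := by
  have hpos := fun i => (hA.eigenvalues_pos i).le
  have h := Real.geom_mean_le_arith_mean Finset.univ (fun _ => 1) hA.1.eigenvalues (by simp)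
    (by simpa using Nat.pos_of_ne_zero hn) fun i _ => hpos i
  simp only [Real.rpow_one, one_mul, Finset.sum_const, Finset.card_univ, Fintype.card_fin,
    nsmul_eq_mul, mul_one] at h
  have hdet := hA.1.det_eq_prod_eigenvalues
  have htr := hA.1.trace_eq_sum_eigenvalues
  simp only [RCLike.ofReal_real_eq_id, id_eq] at hdet htr
  rw [← hdet, ← htr] at h
  calc A.det = (A.det ^ ((n : ℝ)⁻¹)) ^ n := (Real.rpow_inv_natCast_pow hA.det_pos.le hn).symm
    _ ≤ (A.trace / n) ^ n := pow_le_pow_left₀ (Real.rpow_nonneg hA.det_pos.le _) h n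

lemma trace_le_inhomMin {u β : ℝ} (hq : 231 * u ^ 2 - 70 * u - 13 = 0) (h1 : 0.433 < u)
    (h2 : u < 0.43301) (hβ : 1 ≤ β) {H : Matrix (Fin 6) (Fin 6) ℝ} (hH : H.PosDef)
    (hnear : ∀ i j, |H i j - glueForm u β i j| ≤ 1 / 100000) :
    (21 * u ^ 2 - 14 * u + 13) / 4 * ((H 0 0 / u + ∑ k : Fin 5, H k.succ k.succ) / 6) ≤
      inhomMin (glueBasis.transpose * H * glueBasis) := by
  have hu : u ≠ 0 := by linarith
  set d : Fin 6 → ℝ := fun i =>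
    (∑ k, deepBary.mulVec ![2, 1 - u, 1 - u, 1 - u, (3 * u - 1) / 2, 0] k *
      (deepVertex k i * deepVertex k i)) -
      ![2, 1 - u, 1 - u, 1 - u, (3 * u - 1) / 2, 0] i *
        ![2, 1 - u, 1 - u, 1 - u, (3 * u - 1) / 2, 0] i with hd
  have hlb : IsLowerBound u β (Matrix.diagonal d) := (isLowerBound_deep h1 h2 hβ
    ![2, 1 - u, 1 - u, 1 - u, (3 * u - 1) / 2, 0]).diagonal
  -- The coefficient (21u - 7)/2 is r'(u); it equals r(u)/(6u) precisely by the stationarity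
  -- equation.
  have hd0 : d 0 = (21 * u ^ 2 - 14 * u + 13) / (24 * u) := by
    have : d 0 = (21 * u - 7) / 2 := by
      simp [hd, deepBary, deepVertex, Matrix.mulVec, dotProduct, Fin.sum_univ_six]
      ring
    rw [this, eq_div_iff (by positivity)]
    linear_combination hq
  have hd1 : ∑ k : Fin 5, d k.succ = 5 * (21 * u ^ 2 - 14 * u + 13) / 24 := by
    simp [hd, deepBary, deepVertex, Matrix.mulVec, dotProduct, Fin.sum_univ_five,
      Fin.sum_univ_six]
    linear_combination (-1 / 24) * hq
  -- The five cyclic shifts already equalise the last five diagonal coefficients.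
  have hsum : ∑ t : Fin 5, (d 0 * H 0 0 + ∑ k : Fin 5, d k.succ * H (k + t).succ (k + t).succ) ≤
      ∑ _t : Fin 5, inhomMin (glueBasis.transpose * H * glueBasis) :=
    Finset.sum_le_sum fun t _ => hlb.perm (Equiv.addRight t) hH hnear
  rw [Finset.sum_add_distrib, Finset.sum_comm] at hsum
  simp_rw [← Finset.mul_sum] at hsum
  have hrot : ∀ k : Fin 5, ∑ t : Fin 5, H (k + t).succ (k + t).succ =
      ∑ t : Fin 5, H t.succ t.succ := fun k =>
    Equiv.sum_comp (Equiv.addLeft k) fun t : Fin 5 => H t.succ t.succ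
  simp_rw [hrot] at hsum
  rw [← Finset.sum_mul, hd1, hd0] at hsum
  simp only [Finset.sum_const, Finset.card_univ, Fintype.card_fin, nsmul_eq_mul] at hsum
  push_cast at hsum
  refine le_of_mul_le_mul_left (le_trans (le_of_eq ?_) hsum) (by norm_num : (0 : ℝ) < 5)
  field_simp
  ring

lemma det_le_inhomMin {u β : ℝ} (hq : 231 * u ^ 2 - 70 * u - 13 = 0) (h1 : 0.433 < u)
    (h2 : u < 0.43301) (hβ : 1 ≤ β) {H : Matrix (Fin 6) (Fin 6) ℝ} (hH : H.PosDef)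
    (hnear : ∀ i j, |H i j - glueForm u β i j| ≤ 1 / 100000) :
    ((21 * u ^ 2 - 14 * u + 13) / 4) ^ 6 * (H.det / u) ≤
      inhomMin (glueBasis.transpose * H * glueBasis) ^ 6 := by
  have hu : 0 < u := by linarith
  have hs : 0 < Real.sqrt u := Real.sqrt_pos.mpr hu
  have hss : (Real.sqrt u)⁻¹ * (Real.sqrt u)⁻¹ = u⁻¹ := by
    rw [← mul_inv, Real.mul_self_sqrt hu.le]
  -- Rescaling by diag(u,1,…,1)^(-1/2) makes the linear bound a plain trace.
  set D : Matrix (Fin 6) (Fin 6) ℝ := Matrix.diagonal (Matrix.vecCons (Real.sqrt u)⁻¹ 1) with hD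
  have hDdet : D.det = (Real.sqrt u)⁻¹ := by
    rw [hD, Matrix.det_diagonal, Fin.prod_univ_succ]
    simp
  have hpd : (D.transpose * H * D).PosDef :=
    posDef_conj (by rw [hDdet]; exact (inv_pos.mpr hs).ne'.isUnit) hH
  have hdet : (D.transpose * H * D).det = H.det / u := by
    rw [Matrix.det_mul, Matrix.det_mul, Matrix.det_transpose, hDdet, div_eq_mul_inv, ← hss]
    ring
  have htr : (D.transpose * H * D).trace = H 0 0 / u + ∑ k : Fin 5, H k.succ k.succ := by
    rw [Matrix.trace, Fin.sum_univ_succ, hD, Matrix.diagonal_transpose]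
    simp only [Matrix.diag_apply, Matrix.mul_diagonal, Matrix.diagonal_mul, Matrix.cons_val_zero,
      Matrix.cons_val_succ, Pi.one_apply, one_mul, mul_one]
    rw [div_eq_mul_inv, ← hss]
    ring
  have ham := det_le_trace_div_pow (by norm_num) hpd
  have htr0 := hpd.posSemidef.trace_nonneg
  rw [hdet, htr] at ham
  rw [htr] at htr0
  have hf : 0 ≤ (21 * u ^ 2 - 14 * u + 13) / 4 := by nlinarith
  calc _ ≤ ((21 * u ^ 2 - 14 * u + 13) / 4) ^ 6 *
        ((H 0 0 / u + ∑ k : Fin 5, H k.succ k.succ) / (6 : ℕ)) ^ 6 :=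
        mul_le_mul_of_nonneg_left ham (by positivity)
    _ = ((21 * u ^ 2 - 14 * u + 13) / 4 *
        ((H 0 0 / u + ∑ k : Fin 5, H k.succ k.succ) / 6)) ^ 6 := by rw [mul_pow]; norm_num
    _ ≤ _ := pow_le_pow_left₀ (mul_nonneg hf (by positivity))
        (trace_le_inhomMin hq h1 h2 hβ hH hnear) 6

lemma inhomMin_glueForm {u β : ℝ} (hq : 231 * u ^ 2 - 70 * u - 13 = 0) (h1 : 0.433 < u)
    (h2 : u < 0.43301) (hβ : 1 ≤ β) :
    inhomMin (glueBasis.transpose * glueForm u β * glueBasis) =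
      β * ((21 * u ^ 2 - 14 * u + 13) / 4) := by
  have hu : 0 < u := by linarith
  refine le_antisymm (inhomMin_glueForm_le (by linarith) hq h1 h2)
    (le_trans (le_of_eq ?_) (trace_le_inhomMin hq h1 h2 hβ
      (glueForm_posDef hu (by linarith)) (by simp)))
  have : glueForm u β 0 0 / u + ∑ k : Fin 5, glueForm u β k.succ k.succ = 6 * β := by
    simp [glueForm, Fin.sum_univ_five]
    field_simp
    ring
  rw [this]
  ring

/-! ### The explicit parameters and the value of the density -/

/-- The ratio `(35 + 2√1057) / 231`, the positive root of `231 u² - 70 u - 13`. -/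
noncomputable def optRatio : ℝ := (35 + 2 * Real.sqrt 1057) / 231

/-- The scale factor of `Qc2`. -/
noncomputable def optScale : ℝ := (259 + 5 * Real.sqrt 1057) / 352

lemma sqrt_1057_bounds : 32.5115364140177 < Real.sqrt 1057 ∧ Real.sqrt 1057 < 32.5115364140178 := by
  constructor
  · exact Real.lt_sqrt_of_sq_lt (by norm_num)
  · exact (Real.sqrt_lt' (by norm_num)).mpr (by norm_num)

lemma sqrt_1057_sq : Real.sqrt 1057 ^ 2 = 1057 := Real.sq_sqrt (by norm_num)

lemma optRatio_root : 231 * optRatio ^ 2 - 70 * optRatio - 13 = 0 := by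
  unfold optRatio
  linear_combination (4 / 231) * sqrt_1057_sq

lemma lt_optRatio : 0.433 < optRatio := by
  unfold optRatio
  linarith [sqrt_1057_bounds.1]

lemma optRatio_lt : optRatio < 0.43301 := by
  unfold optRatio
  linarith [sqrt_1057_bounds.2]

lemma one_le_optScale : 1 ≤ optScale := by
  unfold optScale
  linarith [sqrt_1057_bounds.1]

lemma Qc2_eq : Qc2 = glueBasis.transpose * glueForm optRatio optScale * glueBasis := by
  have e : optScale * optRatio = (85 + 3 * Real.sqrt 1057) / 352 := by
    unfold optScale optRatio
    linear_combination (10 / (352 * 231)) * sqrt_1057_sq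
  ext i j
  rw [glueForm, e, optScale]
  fin_cases i <;> fin_cases j <;>
    simp [Qc2, QE6star, R1, glueBasis, Matrix.mul_apply, Fin.sum_univ_six,
      Matrix.diagonal_apply] <;> ring

lemma coveringDensity_glue (H : Matrix (Fin 6) (Fin 6) ℝ) :
    coveringDensity (glueBasis.transpose * H * glueBasis) =
      Real.sqrt (inhomMin (glueBasis.transpose * H * glueBasis) ^ 6 / (4096 * H.det)) *
        unitBallVolume 6 := by
  have : (glueBasis.transpose * H * glueBasis).det = 4096 * H.det := by
    rw [Matrix.det_mul, Matrix.det_mul, Matrix.det_transpose, ← glueBasis_det_sq]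
    ring
  rw [coveringDensity, this]

lemma coveringDensity_glueForm {u β : ℝ} (hq : 231 * u ^ 2 - 70 * u - 13 = 0) (h1 : 0.433 < u)
    (h2 : u < 0.43301) (hβ : 1 ≤ β) :
    coveringDensity (glueBasis.transpose * glueForm u β * glueBasis) =
      Real.sqrt (((21 * u ^ 2 - 14 * u + 13) / 4) ^ 6 / (4096 * u)) * unitBallVolume 6 := by
  have hβ0 : β ≠ 0 := by linarith
  rw [coveringDensity_glue, inhomMin_glueForm hq h1 h2 hβ, glueForm_det]
  congr 2
  rw [mul_pow, ← mul_assoc, mul_comm (β ^ 6), mul_div_mul_right _ _ (pow_ne_zero 6 hβ0)]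

lemma coveringDensity_glueForm_le {u β : ℝ} (hq : 231 * u ^ 2 - 70 * u - 13 = 0)
    (h1 : 0.433 < u) (h2 : u < 0.43301) (hβ : 1 ≤ β) {H : Matrix (Fin 6) (Fin 6) ℝ}
    (hH : H.PosDef) (hnear : ∀ i j, |H i j - glueForm u β i j| ≤ 1 / 100000) :
    coveringDensity (glueBasis.transpose * glueForm u β * glueBasis) ≤
      coveringDensity (glueBasis.transpose * H * glueBasis) := by
  have hu : 0 < u := by linarith
  rw [coveringDensity_glueForm hq h1 h2 hβ, coveringDensity_glue]
  refine mul_le_mul_of_nonneg_right (Real.sqrt_le_sqrt ?_) ENNReal.toReal_nonneg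
  rw [le_div_iff₀ (mul_pos (by norm_num) hH.det_pos)]
  refine le_trans (le_of_eq ?_) (det_le_inhomMin hq h1 h2 hβ hH hnear)
  field_simp

lemma isLocallyOptimalLatticeCovering_glueForm {u β : ℝ} (hq : 231 * u ^ 2 - 70 * u - 13 = 0)
    (h1 : 0.433 < u) (h2 : u < 0.43301) (hβ : 1 ≤ β) :
    IsLocallyOptimalLatticeCovering (glueBasis.transpose * glueForm u β * glueBasis) := by
  have hB := glueBasis_isUnit_det
  have hB' : IsUnit glueBasis⁻¹.det := Matrix.isUnit_nonsing_inv_det _ hB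
  refine ⟨posDef_conj hB (glueForm_posDef (by linarith) (by linarith)), ?_⟩
  set φ : Matrix (Fin 6) (Fin 6) ℝ → Matrix (Fin 6) (Fin 6) ℝ :=
    fun Q => glueBasis⁻¹.transpose * Q * glueBasis⁻¹ with hφ
  have hinv : ∀ Q, glueBasis.transpose * φ Q * glueBasis = Q := by
    intro Q
    have e : glueBasis.transpose * glueBasis⁻¹.transpose = 1 := by
      rw [← Matrix.transpose_mul, Matrix.nonsing_inv_mul _ hB, Matrix.transpose_one]
    calc _ = (glueBasis.transpose * glueBasis⁻¹.transpose) * Q * (glueBasis⁻¹ * glueBasis) := by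
          simp only [hφ, Matrix.mul_assoc]
      _ = Q := by rw [e, Matrix.nonsing_inv_mul _ hB, Matrix.one_mul, Matrix.mul_one]
  have hφ0 : φ (glueBasis.transpose * glueForm u β * glueBasis) = glueForm u β := by
    have e : glueBasis⁻¹.transpose * glueBasis.transpose = 1 := by
      rw [← Matrix.transpose_mul, Matrix.mul_nonsing_inv _ hB, Matrix.transpose_one]
    calc _ = (glueBasis⁻¹.transpose * glueBasis.transpose) * glueForm u β *
          (glueBasis * glueBasis⁻¹) := by simp only [hφ, Matrix.mul_assoc]
      _ = glueForm u β := by rw [e, Matrix.mul_nonsing_inv _ hB, Matrix.one_mul, Matrix.mul_one]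
  have hcont : Continuous φ := by fun_prop
  have hev : ∀ᶠ Q in nhds (glueBasis.transpose * glueForm u β * glueBasis),
      ∀ i j, |φ Q i j - glueForm u β i j| ≤ 1 / 100000 := by
    refine Filter.eventually_all.mpr fun i => Filter.eventually_all.mpr fun j => ?_
    have hc : Continuous fun Q => |φ Q i j - glueForm u β i j| := by fun_prop
    have ht := hc.tendsto (glueBasis.transpose * glueForm u β * glueBasis)
    refine (ht.eventually_lt_const (u := 1 / 100000) ?_).mono fun _ h => h.le
    rw [hφ0]
    norm_num
  refine eventually_nhdsWithin_iff.mpr (hev.mono fun Q hQ hpd => ?_)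
  rw [← hinv Q]
  exact coveringDensity_glueForm_le hq h1 h2 hβ (posDef_conj hB' hpd) hQ

lemma optRatio_density :
    ((21 * optRatio ^ 2 - 14 * optRatio + 13) / 4) ^ 6 / (4096 * optRatio) =
      (1124895337698 * Real.sqrt 1057 - 33713139497730) / 3543122 ^ 2 := by
  have hu : optRatio ≠ 0 := by linarith [lt_optRatio]
  have hr := sqrt_1057_sq
  -- Stationarity factors r(u) as 21u(3u - 1), so the radicand becomes 21⁶u⁵(3u - 1)⁶/4096,
  -- evaluated in ℚ(√1057).
  have hf : (21 * optRatio ^ 2 - 14 * optRatio + 13) / 4 = 21 * (optRatio * (3 * optRatio - 1)) := by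
    linear_combination (-1 / 4) * optRatio_root
  have hu2 : optRatio ^ 2 = 779 / 7623 + 20 / 7623 * Real.sqrt 1057 := by
    unfold optRatio
    linear_combination (4 / 231 ^ 2) * hr
  have hu4 : optRatio ^ 4 = 1029641 / 58110129 + 31160 / 58110129 * Real.sqrt 1057 := by
    rw [show optRatio ^ 4 = (optRatio ^ 2) ^ 2 by ring, hu2]
    linear_combination (20 / 7623) ^ 2 * hr
  have hu5 : optRatio ^ 5 = 14558525 / 1917634257 + 3149882 / 13423439799 * Real.sqrt 1057 := by
    rw [show optRatio ^ 5 = optRatio ^ 4 * optRatio by ring, hu4, optRatio]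
    linear_combination (31160 / 58110129 * (2 / 231)) * hr
  have hw2 : (3 * optRatio - 1) ^ 2 = 856 / 847 - 24 / 847 * Real.sqrt 1057 := by
    unfold optRatio
    linear_combination (2 / 77) ^ 2 * hr
  have hw4 : (3 * optRatio - 1) ^ 4 = 1341568 / 717409 - 41088 / 717409 * Real.sqrt 1057 := by
    rw [show (3 * optRatio - 1) ^ 4 = ((3 * optRatio - 1) ^ 2) ^ 2 by ring, hw2]
    linear_combination (24 / 847) ^ 2 * hr
  have hw6 : (3 * optRatio - 1) ^ 6 =
      2190702592 / 607645423 - 67368960 / 607645423 * Real.sqrt 1057 := by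
    rw [show (3 * optRatio - 1) ^ 6 = (3 * optRatio - 1) ^ 4 * (3 * optRatio - 1) ^ 2 by ring,
      hw4, hw2]
    linear_combination (41088 / 717409 * (24 / 847)) * hr
  calc _ = 21 ^ 6 / 4096 * optRatio ^ 5 * (3 * optRatio - 1) ^ 6 := by
        rw [hf]
        field_simp
    _ = _ := by
        rw [hu5, hw6]
        linear_combination
          (-(21 ^ 6 / 4096 * (3149882 / 13423439799) * (67368960 / 607645423))) * hr

lemma unitBallVolume_six : unitBallVolume 6 = Real.pi ^ 3 / 6 := by
  rw [unitBallVolume, InnerProductSpace.volume_closedBall_of_dim_even (k := 3) (by simp)]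
  simp [Nat.factorial]
  positivity

lemma coveringDensity_Qc2 :
    coveringDensity Qc2 = Real.sqrt (1124895337698 * Real.sqrt 1057 - 33713139497730) / 3543122 *
      unitBallVolume 6 := by
  rw [Qc2_eq, coveringDensity_glueForm optRatio_root lt_optRatio optRatio_lt one_le_optScale,
    optRatio_density, Real.sqrt_div' _ (by norm_num), Real.sqrt_sq (by norm_num)]

lemma abs_coveringDensity_Qc2_sub_lt : |coveringDensity Qc2 - 2.466121649| < 1 / 10 ^ 9 := by
  obtain ⟨hr1, hr2⟩ := sqrt_1057_bounds
  rw [coveringDensity_Qc2, unitBallVolume_six]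
  set S := Real.sqrt (1124895337698 * Real.sqrt 1057 - 33713139497730) with hS
  -- The radicand magnifies the error in √1057 by about 10¹², hence the long decimal bounds for that
  -- root.
  have hS1 : 1690838.91479 < S := Real.lt_sqrt_of_sq_lt (by norm_num; linarith)
  have hS2 : S < 1690838.91480 :=
    (Real.sqrt_lt' (by norm_num)).mpr (by norm_num; linarith)
  have hp1 : (31.0062766802 : ℝ) < Real.pi ^ 3 :=
    lt_of_lt_of_le (by norm_num) (pow_le_pow_left₀ (by norm_num) Real.pi_gt_d20.le 3)
  have hp2 : Real.pi ^ 3 < 31.0062766804 :=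
    lt_of_le_of_lt (pow_le_pow_left₀ Real.pi_pos.le Real.pi_lt_d20.le 3) (by norm_num)
  have hlow : 1690838.91479 * 31.0062766802 < S * Real.pi ^ 3 := by gcongr
  have hupp : S * Real.pi ^ 3 < 1690838.91480 * 31.0062766804 := by gcongr
  rw [abs_lt]
  constructor <;> norm_num at hlow hupp ⊢ <;> linarith

end LatticeCovering


theorem mainTheorem3 :
    LatticeCovering.IsLocallyOptimalLatticeCovering LatticeCovering.Qc2 ∧
    LatticeCovering.coveringDensity LatticeCovering.Qc2 =
      Real.sqrt (1124895337698 * Real.sqrt 1057 - 33713139497730) / 3543122 *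
        LatticeCovering.unitBallVolume 6 ∧
    |LatticeCovering.coveringDensity LatticeCovering.Qc2 - 2.466121649| < 1 / 10 ^ 9 := by
  refine ⟨?_, LatticeCovering.coveringDensity_Qc2, LatticeCovering.abs_coveringDensity_Qc2_sub_lt⟩
  rw [LatticeCovering.Qc2_eq]
  exact LatticeCovering.isLocallyOptimalLatticeCovering_glueForm LatticeCovering.optRatio_root
    LatticeCovering.lt_optRatio LatticeCovering.optRatio_lt LatticeCovering.one_le_optScale
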